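/- Let $\Delta\ge 2$, $r\ge 0$ and $c\ge 1$ be integers, and let $\Sigma_{\mathrm{in}},\Sigma_{\mathrm{out}}$ be finite sets of input and output labels. **LCL problems.** Graphs are finite, directed and without self-loops; degrees count all incident edges, and distances and neighborhoods ignore edge directions. A labeling problem $\Pi$ assigns to each graph $G=(V,E)$ and each input labeling $x:V\to\Sigma_{\mathrm{in}}$ a set of permissible output labelings $V\to\Sigma_{\mathrm{out}}$, invariantly under isomorphism. It is an LCL problem with checking radius $r$ and degree constraint $\Delta$ if there is a family $\mathcal S$ of centered graphs of radius at most $r$ and maximum degree at most $\Delta$, with input and output labels on their nodes, such that for every graph $G$ of maximum degree at most $\Delta$ and every $x$, a labeling $y:V\to\Sigma_{\mathrm{out}}$ is permissible if and only if for every node $v$ the subgraph induced by the radius-$r$ neighborhood of $v$, centered at $v$ and labeled by the restrictions of $x$ and $y$, belongs to $\mathcal S$ up to isomorphism. A *rooted forest* is an oriented forest in which every node has outdegree at most $1$. **SLOCAL model.** Each node of an $n$-node input graph carries its input label and a unique identifier from $\{1,\dots,n^c\}$. A deterministic SLOCAL algorithm with locality $T(n)$ processes the nodes one by one in an adversarial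 order. When $v$ is processed, it sees $n$ and the subgraph induced by the radius-$T(n)$ neighborhood of $v$, with its edge directions, identifiers and input labels, together with the states and outputs of the nodes in it that were processed before; from this it computes the output label of $v$ and an arbitrary state, which are recorded at $v$. The algorithm *solves* $\Pi$ over rooted forests of maximum degree at most $\Delta$ if, for every such forest, every input labeling, every assignment of identifiers and every processing order, the resulting output labeling is permissible. **Theorem.** Let $\Pi$ be an LCL problem with checking radius $r$ and degree constraint $\Delta$, and let $\mathcal A$ be a deterministic SLOCAL algorithm that solves $\Pi$ over rooted forests of maximum degree at most $\Delta$ with locality $T(n)=o(\log_\Delta n)$, where $n$ is the number of nodes. Then there are a constant $k$ (independent of $n$) and a deterministic SLOCAL algorithm $\mathcal B$ that solves $\Pi$ over rooted forests of maximum degree at most $\Delta$ with locality $k$, that is, with locality $O(1)$. -/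

import Mathlib

open Filter Asymptotics

noncomputable section

namespace LCLModel

/-! ### Directed graphs

Graphs are directed; distances and neighborhoods are taken in the underlying undirected graph. -/

/-- A simple graph has no self-loops. -/
def Loopless {V : Type} (G : Digraph V) : Prop := ∀ v, ¬ G.Adj v v

/-- The degree of `v`: the number of directed edges incident to `v` (for graphs without
self-loops). -/
def degree {V : Type} (G : Digraph V) (v : V) : ℕ :=
  {u | G.Adj u v}.ncard + {u | G.Adj v u}.ncard

/-- All degrees are at most `Δ`. -/
def MaxDegreeLE {V : Type} (G : Digraph V) (Δ : ℕ) : Prop := ∀ v, degree G v ≤ Δ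

/-- The number of edges on a shortest (not necessarily directed) path, `⊤` if there is none. -/
def dist {V : Type} (G : Digraph V) (u v : V) : ℕ∞ := G.toSimpleGraphInclusive.edist u v

/-- The radius-`T` neighborhood of `v`. -/
def ball {V : Type} (G : Digraph V) (T : ℕ) (v : V) : Set V := {w | dist G v w ≤ T}

/-- A rooted forest: a forest in which each edge has exactly one of the two orientations and
every node has outdegree at most one (edges point towards the roots). -/
structure IsRootedForest {V : Type} (G : Digraph V) : Prop where
  loopless : Loopless G
  oriented : ∀ u v, G.Adj u v → ¬ G.Adj v u
  outdegree_le_one : ∀ u v w, G.Adj u v → G.Adj u w → v = w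
  acyclic : G.toSimpleGraphInclusive.IsAcyclic

/-! ### Locally checkable labeling problems -/

/-- A labeling problem assigns to every input-labeled graph its set of permissible output
labelings, in an isomorphism-invariant way. -/
structure LabelingProblem (In Out : Type) where
  permissible : {V : Type} → Digraph V → (V → In) → Set (V → Out)
  iso_closed : ∀ {V W : Type} (G : Digraph V) (H : Digraph W) (φ : G.Adj ≃r H.Adj)
    (input : W → In) (out : W → Out),
    out ∈ permissible H input → out ∘ φ ∈ permissible G (input ∘ φ)

/-- A finite centered graph with input and output labels. -/
structure CenteredLabeledGraph (In Out : Type) where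
  V : Type
  finite : Finite V
  graph : Digraph V
  center : V
  input : V → In
  output : V → Out

/-- Isomorphism of centered labeled graphs. -/
def CenteredLabeledGraph.Isomorphic {In Out : Type} (H K : CenteredLabeledGraph In Out) : Prop :=
  ∃ φ : H.graph.Adj ≃r K.graph.Adj, φ H.center = K.center ∧
    (∀ v, K.input (φ v) = H.input v) ∧ (∀ v, K.output (φ v) = H.output v)

/-- The subgraph induced by the radius-`r` neighborhood of `v`, centered at `v`, with the
restrictions of the two labelings. -/
def localView {In Out V : Type} [Finite V] (G : Digraph V) (input : V → In) (out : V → Out)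
    (r : ℕ) (v : V) : CenteredLabeledGraph In Out where
  V := ball G r v
  finite := inferInstance
  graph := { Adj := fun a b => G.Adj a b }
  center := ⟨v, by simp [ball, dist]⟩
  input := fun w => input w
  output := fun w => out w

/-- `P` is locally checkable with checking radius `r` and degree constraint `Δ`: there is a
family `S` of admissible centered labeled graphs of radius at most `r` and maximum degree at most
`Δ`, such that on every finite simple graph of maximum degree at most `Δ` a labeling is
permissible iff all radius-`r` neighborhoods belong to `S` up to isomorphism. -/
def LabelingProblem.IsLocallyCheckable {In Out : Type} (P : LabelingProblem In Out)
    (r Δ : ℕ) : Prop :=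
  ∃ S : Set (CenteredLabeledGraph In Out),
    (∀ H ∈ S, Loopless H.graph ∧ MaxDegreeLE H.graph Δ ∧ ∀ w, dist H.graph H.center w ≤ r) ∧
    ∀ (V : Type) [Finite V] (G : Digraph V) (input : V → In) (out : V → Out),
      Loopless G → MaxDegreeLE G Δ →
      (out ∈ P.permissible G input ↔
        ∀ v, ∃ H ∈ S, (localView G input out r v).Isomorphic H)

/-! ### The deterministic SLOCAL model -/

/-- What an algorithm sees when a node is processed. Nodes are named by their unique identifiers.
`inputs` lists the visible nodes with their input labels, `edges` the directed edges between
visible nodes, and `memory` the states and outputs of the visible nodes processed before. -/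
structure View (In Out State : Type) where
  center : ℕ
  inputs : Set (ℕ × In)
  edges : Set (ℕ × ℕ)
  memory : Set (ℕ × State × Out)

/-- A deterministic SLOCAL algorithm: from the number `n` of nodes and the current view it
computes the state and the output to be recorded at the processed node. -/
structure SLOCALAlgorithm (In Out : Type) where
  State : Type
  step : ℕ → View In Out State → State × Out

/-- The view of `v` with radius `T`, given the records `mem` of the nodes processed so far. -/
def viewOf {In Out State V : Type} (G : Digraph V) (ident : V → ℕ) (input : V → In) (T : ℕ)
    (mem : V → Option (State × Out)) (v : V) : View In Out State where
  center := ident v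
  inputs := {p | ∃ w ∈ ball G T v, p = (ident w, input w)}
  edges := {p | ∃ u ∈ ball G T v, ∃ w ∈ ball G T v, G.Adj u w ∧ p = (ident u, ident w)}
  memory := {p | ∃ w ∈ ball G T v, ∃ s, mem w = some s ∧ p = (ident w, s)}

open Classical in
/-- Process the node `v` with locality `T`. -/
def SLOCALAlgorithm.process {In Out V : Type} (A : SLOCALAlgorithm In Out) (n T : ℕ)
    (G : Digraph V) (ident : V → ℕ) (input : V → In) (mem : V → Option (A.State × Out)) (v : V) :
    V → Option (A.State × Out) :=
  Function.update mem v (some (A.step n (viewOf G ident input T mem v)))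

/-- The records after processing the nodes one by one in the order given by a list. -/
def SLOCALAlgorithm.run {In Out V : Type} (A : SLOCALAlgorithm In Out) (n T : ℕ)
    (G : Digraph V) (ident : V → ℕ) (input : V → In) (order : List V) :
    V → Option (A.State × Out) :=
  order.foldl (A.process n T G ident input) (fun _ => none)

/-- `A` solves `P` with locality `T(n)` over rooted forests of maximum degree at most `Δ`, where
`n` is the number of nodes: its output is permissible for all input labelings, all assignments of
unique identifiers from `{1, …, n ^ c}` and all processing orders. -/
def SLOCALAlgorithm.Solves {In Out : Type} (A : SLOCALAlgorithm In Out)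
    (P : LabelingProblem In Out) (Δ c : ℕ) (T : ℕ → ℕ) : Prop :=
  ∀ (V : Type) [Finite V] (G : Digraph V), IsRootedForest G → MaxDegreeLE G Δ →
    ∀ (input : V → In) (ident : V → ℕ), Function.Injective ident →
      (∀ v, 1 ≤ ident v ∧ ident v ≤ Nat.card V ^ c) →
    ∀ order : List V, order.Nodup → (∀ v, v ∈ order) →
      ∃ out ∈ P.permissible G input, ∀ v,
        (A.run (Nat.card V) (T (Nat.card V)) G ident input order v).map Prod.snd = some (out v)

end LCLModel

end

noncomputable section

namespace LCLModel

/-! ### Balls -/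

section Balls

variable {V : Type} {G : Digraph V}

theorem mem_ball_iff {T : ℕ} {v w : V} :
    w ∈ ball G T v ↔ ∃ p : G.toSimpleGraphInclusive.Walk v w, p.length ≤ T := by
  constructor
  · intro h
    have h' : G.toSimpleGraphInclusive.edist v w ≤ T := h
    have hne : G.toSimpleGraphInclusive.edist v w ≠ ⊤ :=
      ne_top_of_le_ne_top (ENat.natCast_ne_top T) h'
    obtain ⟨p, hp⟩ := SimpleGraph.exists_walk_of_edist_ne_top hne
    exact ⟨p, by rw [← hp] at h'; exact_mod_cast h'⟩
  · rintro ⟨p, hp⟩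
    exact (SimpleGraph.edist_le p).trans (by exact_mod_cast hp)

theorem mem_ball_self (T : ℕ) (v : V) : v ∈ ball G T v :=
  mem_ball_iff.2 ⟨.nil, Nat.zero_le _⟩

theorem mem_ball_zero {v w : V} : w ∈ ball G 0 v ↔ w = v := by
  rw [mem_ball_iff]
  constructor
  · rintro ⟨p, hp⟩
    exact (SimpleGraph.Walk.eq_of_length_eq_zero (Nat.le_zero.1 hp)).symm
  · rintro rfl
    exact ⟨.nil, le_rfl⟩

theorem mem_ball_symm {T : ℕ} {v w : V} (h : w ∈ ball G T v) : v ∈ ball G T w := by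
  obtain ⟨p, hp⟩ := mem_ball_iff.1 h
  exact mem_ball_iff.2 ⟨p.reverse, by simpa using hp⟩

theorem mem_ball_trans {S T : ℕ} {u v w : V} (h : v ∈ ball G S u) (h' : w ∈ ball G T v) :
    w ∈ ball G (S + T) u := by
  obtain ⟨p, hp⟩ := mem_ball_iff.1 h
  obtain ⟨q, hq⟩ := mem_ball_iff.1 h'
  exact mem_ball_iff.2 ⟨p.append q, by rw [SimpleGraph.Walk.length_append]; omega⟩

theorem ball_mono {S T : ℕ} (h : S ≤ T) (v : V) : ball G S v ⊆ ball G T v := fun w hw => by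
  obtain ⟨p, hp⟩ := mem_ball_iff.1 hw
  exact mem_ball_iff.2 ⟨p, hp.trans h⟩

theorem mem_ball_one_of_adj {v w : V} (h : G.Adj v w ∨ G.Adj w v) : w ∈ ball G 1 v := by
  by_cases hvw : v = w
  · subst hvw
    exact mem_ball_self _ _
  · have : G.toSimpleGraphInclusive.Adj v w := ⟨hvw, h⟩
    exact mem_ball_iff.2 ⟨this.toWalk, by simp⟩

theorem mem_ball_succ {T : ℕ} {v w : V} :
    w ∈ ball G (T + 1) v ↔
      w ∈ ball G T v ∨ ∃ u ∈ ball G T v, G.Adj u w ∨ G.Adj w u := by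
  constructor
  · intro h
    obtain ⟨p, hp⟩ := mem_ball_iff.1 h
    by_cases hle : p.length ≤ T
    · exact Or.inl (mem_ball_iff.2 ⟨p, hle⟩)
    · right
      have hnil : ¬ p.Nil := by
        intro hn
        have := SimpleGraph.Walk.length_eq_zero_iff.2 hn
        omega
      refine ⟨p.penultimate, mem_ball_iff.2 ⟨p.dropLast, ?_⟩, (p.adj_penultimate hnil).2⟩
      rw [SimpleGraph.Walk.length_dropLast]
      omega
  · rintro (h | ⟨u, hu, hadj⟩)
    · exact ball_mono (Nat.le_succ T) v h
    · exact mem_ball_trans hu (mem_ball_one_of_adj hadj)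

theorem ncard_ball_le [Finite V] {Δ : ℕ} (hG : MaxDegreeLE G Δ) (T : ℕ) (v : V) :
    (ball G T v).ncard ≤ (Δ + 1) ^ T := by
  induction T with
  | zero =>
    have : ball G 0 v = {v} := by
      ext w
      simp [mem_ball_zero]
    simp [this]
  | succ T ih =>
    have hfin := (ball G T v).toFinite
    have hsub : ball G (T + 1) v ⊆
        ball G T v ∪ ⋃ u ∈ hfin.toFinset, ({w | G.Adj w u} ∪ {w | G.Adj u w}) := by
      intro w hw
      rcases mem_ball_succ.1 hw with h | ⟨u, hu, h⟩
      · exact Or.inl h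
      · right
        simp only [Set.mem_iUnion]
        exact ⟨u, hfin.mem_toFinset.2 hu, h.symm⟩
    calc (ball G (T + 1) v).ncard
        ≤ (ball G T v).ncard +
          (⋃ u ∈ hfin.toFinset, ({w | G.Adj w u} ∪ {w | G.Adj u w})).ncard :=
          (Set.ncard_le_ncard hsub (Set.toFinite _)).trans (Set.ncard_union_le _ _)
      _ ≤ (ball G T v).ncard + ∑ u ∈ hfin.toFinset, Δ := by
          gcongr
          refine (Finset.set_ncard_biUnion_le _ _).trans (Finset.sum_le_sum fun u _ => ?_)
          exact (Set.ncard_union_le _ _).trans (hG u)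
      _ = (ball G T v).ncard * (Δ + 1) := by
          rw [Finset.sum_const, ← Set.ncard_eq_toFinset_card _ hfin, smul_eq_mul]
          ring
      _ ≤ (Δ + 1) ^ (T + 1) := by
          rw [pow_succ]
          gcongr

end Balls

/-! ### Copying a part of a graph -/

section Copy

variable {V W : Type} {G : Digraph V} {S : Set V} {e : V → W}

/-- The image under `e` of the subgraph of `G` induced by `S`. -/
def copy (G : Digraph V) (S : Set V) (e : V → W) : Digraph W where
  Adj x y := ∃ a ∈ S, ∃ b ∈ S, G.Adj a b ∧ e a = x ∧ e b = y

theorem copy_adj (he : Set.InjOn e S) {a b : V} (ha : a ∈ S) (hb : b ∈ S) :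
    (copy G S e).Adj (e a) (e b) ↔ G.Adj a b := by
  constructor
  · rintro ⟨a', ha', b', hb', h, h1, h2⟩
    rwa [← he ha' ha h1, ← he hb' hb h2]
  · intro h
    exact ⟨a, ha, b, hb, h, rfl, rfl⟩

theorem ball_copy_subset (he : Set.InjOn e S) {a : V} (ha : a ∈ S) (T : ℕ) :
    ball (copy G S e) T (e a) ⊆ e '' (ball G T a ∩ S) := by
  induction T with
  | zero =>
    intro w hw
    rw [mem_ball_zero] at hw
    exact ⟨a, ⟨mem_ball_self _ _, ha⟩, hw.symm⟩
  | succ T ih =>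
    intro w hw
    rcases mem_ball_succ.1 hw with h | ⟨u, hu, h⟩
    · obtain ⟨b, ⟨hb, hbS⟩, rfl⟩ := ih h
      exact ⟨b, ⟨ball_mono (Nat.le_succ T) a hb, hbS⟩, rfl⟩
    · obtain ⟨b, ⟨hb, hbS⟩, rfl⟩ := ih hu
      rcases h with ⟨b', hb', d, hd, hadj, h1, rfl⟩ | ⟨d, hd, b', hb', hadj, rfl, h1⟩
      · obtain rfl := he hb' hbS h1
        exact ⟨d, ⟨mem_ball_succ.2 (Or.inr ⟨b', hb, Or.inl hadj⟩), hd⟩, rfl⟩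
      · obtain rfl := he hb' hbS h1
        exact ⟨d, ⟨mem_ball_succ.2 (Or.inr ⟨b', hb, Or.inr hadj⟩), hd⟩, rfl⟩

theorem map_mem_ball_copy {a b : V} {T : ℕ} (hS : ball G T a ⊆ S) (hb : b ∈ ball G T a) :
    e b ∈ ball (copy G S e) T (e a) := by
  induction T generalizing b with
  | zero =>
    rw [mem_ball_zero] at hb
    subst hb
    exact mem_ball_self _ _
  | succ T ih =>
    have hS' : ball G T a ⊆ S := (ball_mono (Nat.le_succ T) a).trans hS
    rcases mem_ball_succ.1 hb with h | ⟨u, hu, h⟩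
    · exact ball_mono (Nat.le_succ T) _ (ih hS' h)
    · refine mem_ball_succ.2 (Or.inr ⟨e u, ih hS' hu, ?_⟩)
      rcases h with h | h
      · exact Or.inl ⟨u, hS' hu, b, hS hb, h, rfl, rfl⟩
      · exact Or.inr ⟨b, hS hb, u, hS' hu, h, rfl, rfl⟩

theorem ball_copy (he : Set.InjOn e S) {a : V} {T : ℕ} (hS : ball G T a ⊆ S) :
    ball (copy G S e) T (e a) = e '' ball G T a := by
  refine Set.Subset.antisymm (fun w hw => ?_) ?_
  · obtain ⟨b, ⟨hb, -⟩, rfl⟩ := ball_copy_subset he (hS (mem_ball_self _ _)) T hw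
    exact ⟨b, hb, rfl⟩
  · rintro _ ⟨b, hb, rfl⟩
    exact map_mem_ball_copy hS hb

theorem maxDegreeLE_copy [Finite V] (he : Set.InjOn e S) {Δ : ℕ} (hG : MaxDegreeLE G Δ) :
    MaxDegreeLE (copy G S e) Δ := by
  intro x
  by_cases hx : ∃ a ∈ S, e a = x
  · obtain ⟨a, ha, rfl⟩ := hx
    refine le_trans (Nat.add_le_add ?_ ?_) (hG a)
    · refine le_trans (Set.ncard_le_ncard (t := e '' {u | G.Adj u a}) ?_ (Set.toFinite _))
        (Set.ncard_image_le (Set.toFinite _))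
      rintro _ ⟨u, _, a', ha', h, rfl, h2⟩
      obtain rfl := he ha' ha h2
      exact ⟨u, h, rfl⟩
    · refine le_trans (Set.ncard_le_ncard (t := e '' {u | G.Adj a u}) ?_ (Set.toFinite _))
        (Set.ncard_image_le (Set.toFinite _))
      rintro _ ⟨a', ha', u, _, h, h2, rfl⟩
      obtain rfl := he ha' ha h2
      exact ⟨u, h, rfl⟩
  · have h1 : {u | (copy G S e).Adj u x} = ∅ := by
      ext u
      simp only [Set.mem_ofPred_eq, Set.mem_empty_iff_false, iff_false]
      rintro ⟨_, _, b, hb, _, _, h⟩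
      exact hx ⟨b, hb, h⟩
    have h2 : {u | (copy G S e).Adj x u} = ∅ := by
      ext u
      simp only [Set.mem_ofPred_eq, Set.mem_empty_iff_false, iff_false]
      rintro ⟨b, hb, _, _, _, h, _⟩
      exact hx ⟨b, hb, h⟩
    simp [degree, h1, h2]

theorem isRootedForest_copy [Nonempty V] (he : Set.InjOn e S) (hG : IsRootedForest G) :
    IsRootedForest (copy G S e) where
  loopless := by
    rintro _ ⟨a, ha, b, hb, h, rfl, h2⟩
    obtain rfl := he hb ha h2
    exact hG.loopless _ h
  oriented := by
    rintro _ _ ⟨a, ha, b, hb, h, rfl, rfl⟩ h'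
    exact hG.oriented _ _ h ((copy_adj he hb ha).1 h')
  outdegree_le_one := by
    rintro _ _ _ ⟨a, ha, b, hb, h, rfl, rfl⟩ ⟨a', ha', d, hd, h', h1, rfl⟩
    obtain rfl := he ha' ha h1
    rw [hG.outdegree_le_one _ _ _ h h']
  acyclic := by
    set g : W → V := Function.invFunOn e S with hg
    have hge : ∀ a ∈ S, g (e a) = a := fun a ha => he.leftInvOn_invFunOn ha
    rw [SimpleGraph.isAcyclic_iff_forall_adj_isBridge]
    intro x y hxy
    have key : ∀ u w, (copy G S e).toSimpleGraphInclusive.Adj u w →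
        ∃ a ∈ S, ∃ b ∈ S, e a = u ∧ e b = w ∧ G.toSimpleGraphInclusive.Adj a b := by
      rintro u w ⟨hne, ⟨a, ha, b, hb, h, rfl, rfl⟩ | ⟨b, hb, a, ha, h, rfl, rfl⟩⟩
      · exact ⟨a, ha, b, hb, rfl, rfl, fun h => hne (congrArg e h), Or.inl h⟩
      · exact ⟨a, ha, b, hb, rfl, rfl, fun h => hne (congrArg e h), Or.inr h⟩
    obtain ⟨a, ha, b, hb, rfl, rfl, hab⟩ := key x y hxy
    rw [SimpleGraph.isBridge_iff]
    intro hr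
    have hbr := (SimpleGraph.isAcyclic_iff_forall_adj_isBridge.1 hG.acyclic) hab
    rw [SimpleGraph.isBridge_iff] at hbr
    apply hbr
    have hom : ∀ u w, ((copy G S e).toSimpleGraphInclusive.deleteEdges {s(e a, e b)}).Adj u w →
        (G.toSimpleGraphInclusive.deleteEdges {s(a, b)}).Adj (g u) (g w) := by
      intro u w huw
      rw [SimpleGraph.deleteEdges_adj] at huw ⊢
      obtain ⟨a', ha', b', hb', rfl, rfl, hab'⟩ := key u w huw.1
      rw [hge a' ha', hge b' hb']
      refine ⟨hab', fun hmem => huw.2 ?_⟩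
      have := congrArg (Sym2.map e) (Set.mem_singleton_iff.1 hmem)
      simpa using this
    have := hr.map (⟨g, fun {u w} h => hom u w h⟩ :
      (copy G S e).toSimpleGraphInclusive.deleteEdges {s(e a, e b)} →g
        G.toSimpleGraphInclusive.deleteEdges {s(a, b)})
    simpa [hge a ha, hge b hb] using this

end Copy

/-! ### Ancestors -/

section Ancestors

variable {V : Type} {G : Digraph V}

open Classical in
/-- The parent map of a rooted forest in which an infinite directed path is attached to each root:
`(v, 0)` is the node `v`, and `(v, 1), (v, 2), …` are the further nodes above a root `v`. -/
def up (G : Digraph V) (x : V × ℕ) : V × ℕ :=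
  if h : x.2 = 0 ∧ ∃ p, G.Adj x.1 p then (h.2.choose, 0) else (x.1, x.2 + 1)

theorem up_of_adj (hG : IsRootedForest G) {v p : V} (h : G.Adj v p) : up G (v, 0) = (p, 0) := by
  have h' : (v, 0).2 = 0 ∧ ∃ p, G.Adj (v, 0).1 p := ⟨rfl, p, h⟩
  rw [up, dif_pos h', hG.outdegree_le_one _ _ _ h'.2.choose_spec h]

theorem up_of_root {v : V} (h : ∀ p, ¬ G.Adj v p) : up G (v, 0) = (v, 1) := by
  rw [up, dif_neg (by rintro ⟨-, p, hp⟩; exact h p hp)]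

theorem up_succ (v : V) (j : ℕ) : up G (v, j + 1) = (v, j + 2) := by
  rw [up, dif_neg (by rintro ⟨h, -⟩; exact absurd h (Nat.succ_ne_zero j))]

theorem iterate_up_succ (v : V) (j i : ℕ) : (up G)^[i] (v, j + 1) = (v, j + 1 + i) := by
  induction i with
  | zero => rfl
  | succ i ih =>
    rw [Function.iterate_succ_apply', ih, show j + 1 + i = (j + i) + 1 by omega, up_succ]
    exact Prod.ext rfl (by simp only; omega)

theorem adj_of_up {v p : V} (h : up G (v, 0) = (p, 0)) : G.Adj v p := by
  by_cases h' : (v, 0).2 = 0 ∧ ∃ p, G.Adj (v, 0).1 p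
  · rw [up, dif_pos h'] at h
    have hp : h'.2.choose = p := (Prod.ext_iff.1 h).1
    exact hp ▸ h'.2.choose_spec
  · rw [up, dif_neg h'] at h
    exact absurd (Prod.ext_iff.1 h).2 (by simp)

theorem up_fst_mem_ball (x : V × ℕ) : (up G x).1 ∈ ball G 1 x.1 := by
  by_cases h' : x.2 = 0 ∧ ∃ p, G.Adj x.1 p
  · rw [up, dif_pos h']
    exact mem_ball_one_of_adj (Or.inl h'.2.choose_spec)
  · rw [up, dif_neg h']
    exact mem_ball_self _ _

theorem iterate_up_fst_mem_ball (x : V × ℕ) (i : ℕ) : ((up G)^[i] x).1 ∈ ball G i x.1 := by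
  induction i with
  | zero => exact mem_ball_self _ _
  | succ i ih =>
    rw [Function.iterate_succ_apply']
    exact mem_ball_trans ih (up_fst_mem_ball _)

theorem mem_ball_of_iterate_up_eq {u w : V} {a b : ℕ}
    (h : (up G)^[a] (u, 0) = (up G)^[b] (w, 0)) : w ∈ ball G (a + b) u := by
  have h1 := iterate_up_fst_mem_ball (G := G) (u, 0) a
  have h2 := mem_ball_symm (iterate_up_fst_mem_ball (G := G) (w, 0) b)
  rw [h] at h1
  exact mem_ball_trans h1 h2

theorem exists_iterate_up_eq (hG : IsRootedForest G) {T : ℕ} {u w : V} (h : w ∈ ball G T u) :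
    ∃ a b, a + b ≤ T ∧ (up G)^[a] (u, 0) = (up G)^[b] (w, 0) := by
  induction T generalizing w with
  | zero =>
    rw [mem_ball_zero] at h
    exact ⟨0, 0, le_rfl, by rw [h]⟩
  | succ T ih =>
    rcases mem_ball_succ.1 h with h | ⟨x, hx, h⟩
    · obtain ⟨a, b, hab, h⟩ := ih h
      exact ⟨a, b, by omega, h⟩
    · obtain ⟨a, b, hab, hx⟩ := ih hx
      rcases h with h | h
      · cases b with
        | zero =>
          refine ⟨a + 1, 0, by omega, ?_⟩
          rw [Function.iterate_succ_apply', hx]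
          exact up_of_adj hG h
        | succ b =>
          refine ⟨a, b, by omega, ?_⟩
          rw [hx, Function.iterate_succ_apply, up_of_adj hG h]
      · refine ⟨a, b + 1, by omega, ?_⟩
        rw [hx, Function.iterate_succ_apply, up_of_adj hG h]

theorem iterate_up_ne (hG : IsRootedForest G) (v : V) {i : ℕ} (hi : 1 ≤ i) :
    (up G)^[i] (v, 0) ≠ (v, 0) := by
  classical
  intro hper
  have hex : ∃ i, 1 ≤ i ∧ (up G)^[i] (v, 0) = (v, 0) := ⟨i, hi, hper⟩
  obtain ⟨m, ⟨hm1, hm⟩, hmin⟩ : ∃ m, (1 ≤ m ∧ (up G)^[m] (v, 0) = (v, 0)) ∧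
      ∀ j, 1 ≤ j → j < m → (up G)^[j] (v, 0) ≠ (v, 0) :=
    ⟨Nat.find hex, Nat.find_spec hex, fun j hj hlt h => Nat.find_min hex hlt ⟨hj, h⟩⟩
  set c : ℕ → V := fun j => ((up G)^[j] (v, 0)).1 with hc
  have hreal : ∀ j ≤ m, (up G)^[j] (v, 0) = (c j, 0) := by
    intro j hj
    refine Prod.ext rfl ?_
    by_contra hne
    obtain ⟨k, hk⟩ := Nat.exists_eq_succ_of_ne_zero hne
    have hk' : (up G)^[j] (v, 0) = (c j, k + 1) := Prod.ext rfl hk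
    have : (up G)^[m] (v, 0) = (c j, k + 1 + (m - j)) := by
      rw [← iterate_up_succ (G := G), ← hk', ← Function.iterate_add_apply]
      congr 2
      omega
    rw [hm] at this
    have := (Prod.ext_iff.1 this).2
    simp only at this
    omega
  have hadj : ∀ j < m, G.Adj (c j) (c (j + 1)) := by
    intro j hj
    apply adj_of_up
    rw [← hreal j hj.le, ← hreal (j + 1) hj, Function.iterate_succ_apply']
  have hc0 : c 0 = v := rfl
  have hcm : c m = v := by rw [hc]; simp only; rw [hm]
  have hne1 : m ≠ 1 := by
    rintro rfl
    have := hadj 0 Nat.one_pos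
    rw [zero_add, hcm, hc0] at this
    exact hG.loopless _ this
  have hne2 : m ≠ 2 := by
    rintro rfl
    have h0 := hadj 0 (by omega)
    have h1 := hadj 1 (by omega)
    rw [hc0] at h0
    rw [hcm] at h1
    exact hG.oriented _ _ h0 h1
  have hback : ∀ j, 1 ≤ j → j < m → c j ≠ v := fun j h1 h2 h => by
    apply hmin j h1 h2
    rw [hreal j h2.le, h]
  have h01 := hadj 0 (by omega)
  rw [hc0, zero_add] at h01
  have hab : G.toSimpleGraphInclusive.Adj v (c 1) :=
    ⟨fun h => hG.loopless v (by rw [← h] at h01; exact h01), Or.inl h01⟩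
  have hbr := (SimpleGraph.isAcyclic_iff_forall_adj_isBridge.1 hG.acyclic) hab
  rw [SimpleGraph.isBridge_iff] at hbr
  apply hbr
  have hreach : ∀ j, 1 ≤ j → j ≤ m →
      (G.toSimpleGraphInclusive.deleteEdges {s(v, c 1)}).Reachable (c 1) (c j) := by
    intro j hj
    induction j, hj using Nat.le_induction with
    | base => exact fun _ => SimpleGraph.Reachable.refl _
    | succ j hj ih =>
      intro hjm
      refine (ih (by omega)).trans (SimpleGraph.Adj.reachable ?_)
      have hjadj := hadj j (by omega)
      rw [SimpleGraph.deleteEdges_adj]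
      refine ⟨⟨fun h => hG.loopless (c j) (by rw [← h] at hjadj; exact hjadj), Or.inl hjadj⟩, ?_⟩
      intro hmem
      rcases Sym2.eq_iff.1 (Set.mem_singleton_iff.1 hmem) with ⟨h1, -⟩ | ⟨h1, h2⟩
      · exact hback j hj (by omega) h1
      · rw [h1, h2] at hjadj
        exact hG.oriented _ _ h01 hjadj
  have := hreach m hm1 le_rfl
  rw [hcm] at this
  exact this.symm

/-- The copy of an ancestor is an ancestor of the copy, as long as its parent is copied too. -/
theorem iterate_up_copy {W : Type} {S : Set V} {e : V → W} (hG : IsRootedForest G)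
    (hG' : IsRootedForest (copy G S e)) (he : Set.InjOn e S) {v : V} {i : ℕ}
    (hS : ball G i v ⊆ S) :
    (up (copy G S e))^[i] (e v, 0) = Prod.map e id ((up G)^[i] (v, 0)) := by
  induction i with
  | zero => rfl
  | succ i ih =>
    rw [Function.iterate_succ_apply', Function.iterate_succ_apply',
      ih ((ball_mono (Nat.le_succ i) v).trans hS)]
    have hmem := iterate_up_fst_mem_ball (G := G) (v, 0) i
    generalize (up G)^[i] (v, 0) = x at hmem ⊢
    obtain ⟨w, j⟩ := x
    replace hmem : w ∈ ball G i v := hmem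
    have hw : w ∈ S := hS (ball_mono (Nat.le_succ i) v hmem)
    cases j with
    | succ j => simp only [Prod.map_apply, id_eq, up_succ]
    | zero =>
      by_cases h : ∃ p, G.Adj w p
      · obtain ⟨p, hp⟩ := h
        have hpS : p ∈ S := hS (mem_ball_trans hmem (mem_ball_one_of_adj (Or.inl hp)))
        rw [up_of_adj hG hp]
        exact up_of_adj hG' ((copy_adj he hw hpS).2 hp)
      · push Not at h
        rw [up_of_root h]
        refine up_of_root ?_
        rintro _ ⟨a, ha, b, hb, hab, h1, rfl⟩
        obtain rfl := he ha hw h1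
        exact h _ hab

end Ancestors

/-! ### Maximal independent sets on paths -/

/-- The greedy maximal subset of `ℕ` with gaps at least `h`, where `i` is treated at time `s i`. -/
def Chosen (h : ℕ) (s : ℕ → ℕ) (i : ℕ) : Prop :=
  ∀ j, i < j + h → j < i + h → s j < s i → ¬ Chosen h s j
termination_by s i

theorem chosen_congr {h t : ℕ} {s s' : ℕ → ℕ} {i : ℕ} (hi : h * s' i ≤ i)
    (hs : ∀ j ≤ i + h * s' i, s (t + j) = s' j) : Chosen h s (t + i) ↔ Chosen h s' i := by
  obtain ⟨n, hn⟩ : ∃ n, s' i = n := ⟨_, rfl⟩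
  induction n using Nat.strong_induction_on generalizing i with
  | _ n ih =>
    have hsi : s (t + i) = s' i := hs i (by omega)
    have key : ∀ j, i < j + h → j < i + h → s' j < s' i →
        (Chosen h s (t + j) ↔ Chosen h s' j) ∧ s (t + j) = s' j := by
      intro j h1 h2 h3
      have hmul : h * s' j + h ≤ h * s' i := by
        rw [← Nat.mul_succ]
        exact Nat.mul_le_mul_left h h3
      exact ⟨ih (s' j) (hn ▸ h3) (by omega) (fun l hl => hs l (by omega)) rfl, hs j (by omega)⟩
    rw [Chosen, Chosen]
    constructor
    · intro H j h1 h2 h3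
      obtain ⟨k1, k2⟩ := key j h1 h2 h3
      rw [← k1]
      exact H (t + j) (by omega) (by omega) (by omega)
    · intro H j h1 h2 h3
      have hpos : h ≤ h * s' i := Nat.le_mul_of_pos_right h (by omega)
      obtain ⟨j, rfl⟩ : ∃ l, j = t + l := ⟨j - t, by omega⟩
      have hjs : s (t + j) = s' j := hs j (by omega)
      obtain ⟨k1, k2⟩ := key j (by omega) (by omega) (by omega)
      rw [k1]
      exact H j (by omega) (by omega) (by omega)

theorem Chosen.eq {h : ℕ} {s : ℕ → ℕ} (hs : ∀ i j, i < j → j < i + h → s i ≠ s j) {i j : ℕ}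
    (hi : Chosen h s i) (hj : Chosen h s j) (hij : i ≤ j) (hlt : j < i + h) : i = j := by
  by_contra hne
  have hi' := hi
  have hj' := hj
  rw [Chosen] at hi' hj'
  rcases Nat.lt_or_gt_of_ne (hs i j (by omega) hlt) with h' | h'
  · exact hj' i (by omega) (by omega) h' hi
  · exact hi' j (by omega) (by omega) h' hj

theorem exists_chosen {h : ℕ} (hh : 1 ≤ h) (s : ℕ → ℕ) (i : ℕ) :
    ∃ j, i < j + h ∧ j < i + h ∧ Chosen h s j := by
  by_cases hi : Chosen h s i
  · exact ⟨i, by omega, by omega, hi⟩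
  · rw [Chosen] at hi
    push Not at hi
    obtain ⟨j, h1, h2, -, h3⟩ := hi
    exact ⟨j, h1, h2, h3⟩

/-! ### Splitting a forest into layers of bounded height -/

section Layers

variable {V : Type} {G : Digraph V} {M T : ℕ} {χ : V → ℕ}

/-- Extend the coloring `χ` to the paths attached to the roots, with colors greater than `M`. -/
def extColor (M T : ℕ) (χ : V → ℕ) : V × ℕ → ℕ
  | (v, 0) => χ v
  | (_, j + 1) => M + 1 + j % (2 * T + 2)

/-- The colors on the path that leads up from `x`. -/
def pathColor (G : Digraph V) (M T : ℕ) (χ : V → ℕ) (x : V × ℕ) (i : ℕ) : ℕ :=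
  extColor M T χ ((up G)^[i] x)

/-- The nodes on a path that leads up from `x` are marked with gaps of bounded size. Whether `x`
is marked is decided far above `x`. -/
def Marked (G : Digraph V) (M T : ℕ) (χ : V → ℕ) (x : V × ℕ) : Prop :=
  Chosen (2 * T + 2) (pathColor G M T χ x) ((2 * T + 2) * (M + (2 * T + 2)))

/-- One of `x` and the `T` nodes above is marked. -/
def Low (G : Digraph V) (M T : ℕ) (χ : V → ℕ) (x : V × ℕ) : Prop :=
  ∃ i ≤ T, Marked G M T χ ((up G)^[i] x)

open Classical in
/-- The layer of a node, which is decided by an ancestor far above. -/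
def phase (G : Digraph V) (M T : ℕ) (χ : V → ℕ) (v : V) : ℕ :=
  if Low G M T χ ((up G)^[6 * T + 4] (v, 0)) then 0 else 1

/-- A coloring with `M` colors in which nodes within distance `D` have distinct colors. -/
structure IsDistColoring (G : Digraph V) (M D : ℕ) (χ : V → ℕ) : Prop where
  one_le : ∀ v, 1 ≤ χ v
  le : ∀ v, χ v ≤ M
  ne : ∀ v w, w ∈ ball G D v → v ≠ w → χ v ≠ χ w

theorem pathColor_iterate (x : V × ℕ) (t i : ℕ) :
    pathColor G M T χ ((up G)^[t] x) i = pathColor G M T χ x (t + i) := by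
  rw [pathColor, pathColor, ← Function.iterate_add_apply, Nat.add_comm]

theorem extColor_le (hχ : ∀ v, χ v ≤ M) (x : V × ℕ) :
    extColor M T χ x ≤ M + (2 * T + 2) := by
  rcases x with ⟨v, _ | j⟩
  · exact (hχ v).trans (Nat.le_add_right _ _)
  · have := Nat.mod_lt j (show 0 < 2 * T + 2 by omega)
    simp only [extColor]
    omega

theorem extColor_ne (hG : IsRootedForest G) {D : ℕ} (hD : 2 * T + 2 ≤ D)
    (hχ : IsDistColoring G M D χ) (x : V × ℕ) {i : ℕ} (hi : 1 ≤ i) (hi' : i < 2 * T + 2) :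
    extColor M T χ x ≠ extColor M T χ ((up G)^[i] x) := by
  rcases x with ⟨v, _ | j⟩
  · have hne := iterate_up_ne hG v hi
    have hmem := iterate_up_fst_mem_ball (G := G) (v, 0) i
    generalize (up G)^[i] (v, 0) = y at hne hmem ⊢
    rcases y with ⟨w, _ | l⟩
    · exact hχ.ne v w (ball_mono (by omega) v hmem) (fun h => hne (by rw [h]))
    · have := hχ.le v
      simp only [extColor]
      omega
  · rw [iterate_up_succ, show j + 1 + i = (j + i) + 1 by omega]
    simp only [extColor]
    intro h
    have h1 : j ≡ j + i [MOD 2 * T + 2] := by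
      have h2 : j % (2 * T + 2) = (j + i) % (2 * T + 2) := by omega
      exact h2
    have h2 := (Nat.modEq_iff_dvd' (Nat.le_add_right j i)).1 h1
    rw [Nat.add_sub_cancel_left] at h2
    exact absurd (Nat.le_of_dvd hi h2) (by omega)

theorem marked_iterate (hχ : ∀ v, χ v ≤ M) (x : V × ℕ) (t : ℕ) :
    Marked G M T χ ((up G)^[t] x) ↔ Chosen (2 * T + 2) (pathColor G M T χ x)
      (t + (2 * T + 2) * (M + (2 * T + 2))) := by
  rw [Marked]
  refine (chosen_congr ?_ fun j _ => (pathColor_iterate x t j).symm).symm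
  exact Nat.mul_le_mul_left _ (extColor_le hχ _)

theorem exists_marked (hχ : ∀ v, χ v ≤ M) (x : V × ℕ) (t : ℕ) :
    ∃ i, t ≤ i ∧ i ≤ t + (4 * T + 2) ∧ Marked G M T χ ((up G)^[i] x) := by
  obtain ⟨j, h1, h2, h3⟩ := exists_chosen (h := 2 * T + 2) (by omega) (pathColor G M T χ x)
    (t + (2 * T + 1) + (2 * T + 2) * (M + (2 * T + 2)))
  generalize hL : (2 * T + 2) * (M + (2 * T + 2)) = L at h1 h2
  refine ⟨j - L, by omega, by omega, ?_⟩
  rw [marked_iterate hχ, hL, Nat.sub_add_cancel (by omega)]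
  exact h3

theorem marked_eq (hG : IsRootedForest G) {D : ℕ} (hD : 2 * T + 2 ≤ D)
    (hχ : IsDistColoring G M D χ) (x : V × ℕ) {i j : ℕ} (hij : i ≤ j) (hlt : j < i + (2 * T + 2))
    (hi : Marked G M T χ ((up G)^[i] x)) (hj : Marked G M T χ ((up G)^[j] x)) : i = j := by
  rw [marked_iterate hχ.le] at hi hj
  have := Chosen.eq (fun k l hkl hl => ?_) hi hj (by omega) (by omega)
  · omega
  · have := extColor_ne hG hD hχ ((up G)^[k] x) (i := l - k) (by omega) (by omega)
    rwa [← Function.iterate_add_apply, Nat.sub_add_cancel hkl.le] at this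

theorem exists_low (hχ : ∀ v, χ v ≤ M) (x : V × ℕ) (t : ℕ) :
    ∃ i, t ≤ i ∧ i ≤ t + (4 * T + 3) ∧ Low G M T χ ((up G)^[i] x) := by
  obtain ⟨i, h1, h2, h3⟩ := exists_marked (T := T) hχ x t
  exact ⟨i, h1, by omega, 0, Nat.zero_le _, h3⟩

theorem exists_not_low (hG : IsRootedForest G) {D : ℕ} (hD : 2 * T + 2 ≤ D)
    (hχ : IsDistColoring G M D χ) (x : V × ℕ) (t : ℕ) :
    ∃ i, t ≤ i ∧ i ≤ t + (4 * T + 3) ∧ ¬ Low G M T χ ((up G)^[i] x) := by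
  obtain ⟨i, h1, h2, h3⟩ := exists_marked (T := T) hχ.le x t
  refine ⟨i + 1, by omega, by omega, ?_⟩
  rintro ⟨j, hj, h⟩
  rw [← Function.iterate_add_apply] at h
  have := marked_eq hG hD hχ x (by omega) (by omega) h3 h
  omega

theorem low_iff_of_change (hG : IsRootedForest G) {D : ℕ} (hD : 2 * T + 2 ≤ D)
    (hχ : IsDistColoring G M D χ) (x : V × ℕ) {t j : ℕ} (hj : j ≤ T)
    (hch : ¬ (Low G M T χ ((up G)^[t] x) ↔ Low G M T χ ((up G)^[t + 1] x))) :
    Low G M T χ ((up G)^[t + 1 + j] x) ↔ Low G M T χ ((up G)^[t + 1] x) := by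
  have hlow : ∀ t, Low G M T χ ((up G)^[t] x) ↔
      ∃ i, t ≤ i ∧ i ≤ t + T ∧ Marked G M T χ ((up G)^[i] x) := by
    intro t
    constructor
    · rintro ⟨i, hi, h⟩
      rw [← Function.iterate_add_apply] at h
      exact ⟨i + t, by omega, by omega, h⟩
    · rintro ⟨i, h1, h2, h⟩
      refine ⟨i - t, by omega, ?_⟩
      rwa [← Function.iterate_add_apply, Nat.sub_add_cancel h1]
  rw [hlow, hlow] at hch
  rw [hlow, hlow]
  by_cases h1 : ∃ i, t + 1 ≤ i ∧ i ≤ t + 1 + T ∧ Marked G M T χ ((up G)^[i] x)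
  · refine iff_of_true ?_ h1
    obtain ⟨i, hi1, hi2, hi⟩ := h1
    have hi3 : i = t + 1 + T := by
      by_contra hne
      exact hch (iff_of_true ⟨i, by omega, by omega, hi⟩ ⟨i, hi1, hi2, hi⟩)
    exact ⟨i, by omega, by omega, hi⟩
  · refine iff_of_false ?_ h1
    have h0 : ∃ i, t ≤ i ∧ i ≤ t + T ∧ Marked G M T χ ((up G)^[i] x) := by
      by_contra h0
      exact hch (iff_of_false h0 h1)
    obtain ⟨i, hi1, hi2, hi⟩ := h0
    have hit : i = t := by
      by_contra hne
      exact h1 ⟨i, by omega, by omega, hi⟩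
    subst hit
    rintro ⟨l, hl1, hl2, hl⟩
    have := marked_eq hG hD hχ x (by omega) (by omega) hi hl
    omega

theorem phase_eq_iff {u w : V} : phase G M T χ u = phase G M T χ w ↔
    (Low G M T χ ((up G)^[6 * T + 4] (u, 0)) ↔ Low G M T χ ((up G)^[6 * T + 4] (w, 0))) := by
  unfold phase
  split_ifs with h1 h2 h2 <;> simp only [h1, h2] <;> decide

/-- A node is contained in a set of bounded radius that cannot be left by steps of length at most
`T` within its layer. -/
theorem exists_phase_component (hG : IsRootedForest G) {D : ℕ} (hD : 2 * T + 2 ≤ D)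
    (hχ : IsDistColoring G M D χ) (u : V) :
    ∃ C ⊆ ball G (10 * T + 8) u, u ∈ C ∧
      ∀ w ∈ C, ∀ w' ∈ ball G T w, phase G M T χ w' = phase G M T χ u → w' ∈ C := by
  classical
  set s := 6 * T + 4 with hs
  set P : ℕ → Prop := fun i => Low G M T χ ((up G)^[i + s] (u, 0)) with hP
  have hex : ∃ m, ¬ (P m ↔ P 0) := by
    by_cases h0 : P 0
    · obtain ⟨i, hi, -, h⟩ := exists_not_low hG hD hχ (u, 0) s
      refine ⟨i - s, fun h' => h ?_⟩
      have := h'.2 h0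
      rwa [hP, Nat.sub_add_cancel hi] at this
    · obtain ⟨i, hi, -, h⟩ := exists_low (T := T) (G := G) hχ.le (u, 0) s
      refine ⟨i - s, fun h' => h0 (h'.1 ?_)⟩
      show Low G M T χ ((up G)^[i - s + s] (u, 0))
      rwa [Nat.sub_add_cancel hi]
  obtain ⟨m, hm, hmin⟩ : ∃ m, ¬ (P m ↔ P 0) ∧ ∀ j < m, (P j ↔ P 0) :=
    ⟨Nat.find hex, Nat.find_spec hex, fun j hj => not_not.1 (Nat.find_min hex hj)⟩
  have hrun : ∀ t, ∃ i, t ≤ i ∧ i ≤ t + (4 * T + 3) ∧ ¬ (P i ↔ P 0) := by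
    intro t
    by_cases h0 : P 0
    · obtain ⟨i, h1, h2, h⟩ := exists_not_low hG hD hχ (u, 0) (t + s)
      refine ⟨i - s, by omega, by omega, fun h' => h ?_⟩
      have := h'.2 h0
      rwa [hP, Nat.sub_add_cancel (by omega)] at this
    · obtain ⟨i, h1, h2, h⟩ := exists_low (T := T) (G := G) hχ.le (u, 0) (t + s)
      refine ⟨i - s, by omega, by omega, fun h' => h0 (h'.1 ?_)⟩
      show Low G M T χ ((up G)^[i - s + s] (u, 0))
      rwa [Nat.sub_add_cancel (by omega)]
  have hm4 : m ≤ 4 * T + 3 := by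
    obtain ⟨i, -, h2, h⟩ := hrun 0
    by_contra hlt
    exact h (hmin i (by omega))
  have hm0 : m ≠ 0 := by
    rintro rfl
    exact hm Iff.rfl
  have hmT : ∀ j ≤ T, ¬ (P (m + j) ↔ P 0) := by
    intro j hj
    have hm1 := hmin (m - 1) (by omega)
    have hch := low_iff_of_change hG hD hχ (u, 0) (t := m - 1 + s) hj (by
      rw [show m - 1 + s + 1 = m + s by omega]
      intro h
      exact hm (h.symm.trans hm1))
    rw [show m - 1 + s + 1 + j = m + j + s by omega, show m - 1 + s + 1 = m + s by omega] at hch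
    exact fun h => hm (hch.symm.trans h)
  set Q := (up G)^[m + T] (u, 0) with hQ
  set F : ℕ → Prop := fun d => Low G M T χ ((up G)^[s - d] Q) with hF
  have hphase : ∀ w d, d ≤ s → (up G)^[d] (w, 0) = Q →
      (phase G M T χ w = phase G M T χ u ↔ (F d ↔ P 0)) := by
    intro w d hd hw
    rw [phase_eq_iff, ← hs, hF, hP]
    simp only [Nat.zero_add]
    rw [← hw, ← Function.iterate_add_apply, Nat.sub_add_cancel hd]
  have hFP : ∀ d ≤ T, ¬ (F d ↔ P 0) := by
    intro d hd
    have := hmT (T - d) (by omega)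
    rw [hF]
    simp only
    rw [hQ, ← Function.iterate_add_apply, show s - d + (m + T) = m + (T - d) + s by omega]
    exact this
  have hFu : ∀ d, T < d → d ≤ T + m → (F d ↔ P 0) := by
    intro d h1 h2
    have := hmin (m + T - d) (by omega)
    rw [hF]
    simp only
    rw [hQ, ← Function.iterate_add_apply, show s - d + (m + T) = m + T - d + s by omega]
    exact this
  have hFlen : ∀ d ≤ s, (∀ i, T < i → i ≤ d → (F i ↔ P 0)) → d ≤ T + (4 * T + 3) := by
    intro d hds hd
    by_contra hlt
    have hkey : ∃ i, T < i ∧ i ≤ d ∧ ¬ (F i ↔ P 0) := by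
      by_cases h0 : P 0
      · obtain ⟨i, h1, h2, h⟩ := exists_not_low hG hD hχ Q (s - d)
        refine ⟨s - i, by omega, by omega, fun h' => h ?_⟩
        have := h'.2 h0
        rw [hF] at this
        rwa [show s - (s - i) = i by omega] at this
      · obtain ⟨i, h1, h2, h⟩ := exists_low (T := T) (G := G) hχ.le Q (s - d)
        refine ⟨s - i, by omega, by omega, fun h' => h0 (h'.1 ?_)⟩
        rw [hF]
        simp only
        rwa [show s - (s - i) = i by omega]
    obtain ⟨i, h1, h2, h3⟩ := hkey
    exact h3 (hd i h1 h2)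
  refine ⟨{w | ∃ d, T < d ∧ d ≤ s ∧ (up G)^[d] (w, 0) = Q ∧
    ∀ i, T < i → i ≤ d → (F i ↔ P 0)}, ?_, ?_, ?_⟩
  · rintro w ⟨d, h1, h2, hw, hd⟩
    have := hFlen d h2 hd
    exact ball_mono (by omega) u (mem_ball_of_iterate_up_eq (hQ.symm.trans hw.symm))
  · exact ⟨m + T, by omega, by omega, rfl, fun i h1 h2 => hFu i h1 (by omega)⟩
  · rintro w ⟨d, h1, h2, hw, hd⟩ w' hw' hph
    obtain ⟨a, b, hab, heq⟩ := exists_iterate_up_eq hG hw'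
    have hlen := hFlen d h2 hd
    have hw'Q : (up G)^[d - a + b] (w', 0) = Q := by
      rw [Function.iterate_add_apply, ← heq, ← Function.iterate_add_apply,
        Nat.sub_add_cancel (by omega), hw]
    have hds : d - a + b ≤ s := by omega
    have hFd := (hphase w' _ hds hw'Q).1 hph
    have hTd : T < d - a + b := by
      by_contra hle
      exact hFP _ (by omega) hFd
    refine ⟨d - a + b, hTd, hds, hw'Q, fun i hi1 hi2 => ?_⟩
    by_contra hi
    have hid : d < i := by
      by_contra hle
      exact hi (hd i hi1 (by omega))
    obtain ⟨e, ⟨he1, he2⟩, hemin⟩ : ∃ e, (i < e ∧ (F e ↔ P 0)) ∧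
        ∀ l, i < l → l < e → ¬ (F l ↔ P 0) := by
      have hex' : ∃ e, i < e ∧ (F e ↔ P 0) := by
        refine ⟨d - a + b, lt_of_le_of_ne hi2 ?_, hFd⟩
        rintro rfl
        exact hi hFd
      exact ⟨Nat.find hex', Nat.find_spec hex', fun l h1 h2 h3 => Nat.find_min hex' h2 ⟨h1, h3⟩⟩
    have he3 : e ≤ d - a + b := by
      by_contra hlt
      refine hemin (d - a + b) (lt_of_le_of_ne hi2 ?_) (by omega) hFd
      rintro rfl
      exact hi hFd
    have he4 : ¬ (F (e - 1) ↔ P 0) := by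
      rcases Nat.lt_or_ge i (e - 1) with h | h
      · exact hemin (e - 1) h (by omega)
      · rwa [show e - 1 = i by omega]
    have hch := low_iff_of_change hG hD hχ Q (t := s - e) (j := e - 1 - d) (by omega) (by
      rw [show s - e + 1 = s - (e - 1) by omega]
      exact fun h => he4 (h.symm.trans he2))
    rw [show s - e + 1 + (e - 1 - d) = s - d by omega,
      show s - e + 1 = s - (e - 1) by omega] at hch
    exact he4 (hch.symm.trans (hd d h1 le_rfl))

/-- Layers only depend on a neighborhood of bounded radius. -/
theorem phase_copy {W : Type} {S : Set V} {e : V → W} (hG : IsRootedForest G)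
    (hG' : IsRootedForest (copy G S e)) (he : Set.InjOn e S) (hχ : ∀ v, χ v ≤ M) {χ' : W → ℕ}
    {v : V} {K : ℕ} (hK : 7 * T + 4 + 2 * ((2 * T + 2) * (M + (2 * T + 2))) ≤ K)
    (hS : ball G K v ⊆ S) (hχ' : ∀ a ∈ ball G K v, χ' (e a) = χ a) :
    phase (copy G S e) M T χ' (e v) = phase G M T χ v := by
  have hcol : ∀ i ≤ K, pathColor (copy G S e) M T χ' (e v, 0) i =
      pathColor G M T χ (v, 0) i := by
    intro i hi
    rw [pathColor, pathColor, iterate_up_copy hG hG' he ((ball_mono hi v).trans hS)]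
    have hmem := ball_mono hi v (iterate_up_fst_mem_ball (G := G) (v, 0) i)
    generalize (up G)^[i] (v, 0) = x at hmem ⊢
    rcases x with ⟨w, _ | j⟩
    · exact hχ' w hmem
    · rfl
  have hmark : ∀ i ≤ T, (Marked (copy G S e) M T χ' ((up (copy G S e))^[i + (6 * T + 4)] (e v, 0))
      ↔ Marked G M T χ ((up G)^[i + (6 * T + 4)] (v, 0))) := by
    intro i hi
    have hle : ∀ j, (2 * T + 2) * pathColor G M T χ (v, 0) j ≤
        (2 * T + 2) * (M + (2 * T + 2)) := fun j => Nat.mul_le_mul_left _ (extColor_le hχ _)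
    rw [Marked, Marked]
    generalize hL : (2 * T + 2) * (M + (2 * T + 2)) = L at hle hK
    rw [← Nat.zero_add L]
    conv_rhs => rw [Nat.zero_add L]
    refine chosen_congr ?_ fun j hj => ?_
    · rw [pathColor_iterate]
      exact hle _
    · rw [pathColor_iterate] at hj
      have := hle (i + (6 * T + 4) + L)
      rw [Nat.zero_add, pathColor_iterate, pathColor_iterate, hcol]
      omega
  have hlow : Low (copy G S e) M T χ' ((up (copy G S e))^[6 * T + 4] (e v, 0)) ↔
      Low G M T χ ((up G)^[6 * T + 4] (v, 0)) := by
    refine exists_congr fun i => and_congr_right fun hi => ?_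
    rw [← Function.iterate_add_apply, ← Function.iterate_add_apply]
    exact hmark i hi
  unfold phase
  by_cases h : Low G M T χ ((up G)^[6 * T + 4] (v, 0))
  · rw [if_pos (hlow.2 h), if_pos h]
  · rw [if_neg (fun h' => h (hlow.1 h')), if_neg h]

end Layers

/-! ### Running an algorithm by increasing rank -/

section Simulation

variable {In Out V : Type} (A : SLOCALAlgorithm In Out) (n T : ℕ)

open Classical in
/-- The record of `v` when the algorithm processes the nodes by increasing rank `ρ`. -/
def record (G : Digraph V) (ident : V → ℕ) (input : V → In) (ρ : V → ℕ) (v : V) :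
    A.State × Out :=
  A.step n (viewOf G ident input T
    (fun w => if _h : ρ w < ρ v then some (record G ident input ρ w) else none) v)
termination_by ρ v

theorem exists_run_eq_record [Finite V] (G : Digraph V) (ident : V → ℕ) (input : V → In)
    {ρ : V → ℕ} (hρ : Function.Injective ρ) :
    ∃ order : List V, order.Nodup ∧ (∀ v, v ∈ order) ∧
      ∀ v, A.run n T G ident input order v = some (record A n T G ident input ρ v) := by
  classical
  have := Fintype.ofFinite V
  obtain ⟨l, hl, hmem, hsort⟩ : ∃ l : List V, l.Nodup ∧ (∀ v, v ∈ l) ∧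
      l.Pairwise (fun a b => ρ a ≤ ρ b) := by
    have hp : ((Finset.univ : Finset V).toList.insertionSort (fun a b => ρ a ≤ ρ b)).Perm
        (Finset.univ : Finset V).toList := List.perm_insertionSort _ _
    have : IsTrans V (fun a b => ρ a ≤ ρ b) := ⟨fun a b c h h' => le_trans h h'⟩
    have : Std.Total (fun a b : V => ρ a ≤ ρ b) := ⟨fun a b => le_total _ _⟩
    exact ⟨_, hp.nodup_iff.2 (Finset.nodup_toList _), fun v => hp.mem_iff.2 (by simp),
      List.pairwise_insertionSort _ _⟩
  have key : ∀ l₂ l₁ : List V, l₁ ++ l₂ = l → ∀ mem : V → Option (A.State × Out),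
      (∀ w, mem w = if w ∈ l₁ then some (record A n T G ident input ρ w) else none) →
      ∀ v, l₂.foldl (A.process n T G ident input) mem v =
        some (record A n T G ident input ρ v) := by
    intro l₂
    induction l₂ with
    | nil =>
      intro l₁ h mem hm v
      rw [List.append_nil] at h
      rw [List.foldl_nil, hm, if_pos (h ▸ hmem v)]
    | cons a l₂ ih =>
      intro l₁ h mem hm v
      rw [List.foldl_cons]
      refine ih (l₁ ++ [a]) (by rw [List.append_assoc, List.singleton_append, h]) _ ?_ v
      intro w
      rw [SLOCALAlgorithm.process]
      by_cases hwa : w = a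
      · subst hwa
        rw [Function.update_self, if_pos (by simp), record]
        congr 3
        funext u
        rw [hm]
        have hu : u ∈ l₁ ↔ ρ u < ρ w := by
          rw [← h, List.pairwise_append] at hsort
          rw [← h] at hl
          constructor
          · intro hu
            refine lt_of_le_of_ne (hsort.2.2 u hu w (by simp)) fun he => ?_
            rw [hρ he] at hu
            exact (List.disjoint_of_nodup_append hl) hu (by simp)
          · intro hu
            by_contra hn
            have hu' := hmem u
            rw [← h, List.mem_append, List.mem_cons] at hu'
            rcases hu' with hu' | rfl | hu'
            · exact hn hu'
            · exact lt_irrefl _ hu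
            · exact absurd ((List.pairwise_cons.1 hsort.2.1).1 u hu') (not_le.2 hu)
        by_cases hlt : ρ u < ρ w
        · rw [if_pos (hu.2 hlt), dif_pos hlt]
        · rw [if_neg (fun h => hlt (hu.1 h)), dif_neg hlt]
      · rw [Function.update_of_ne hwa, hm]
        simp [hwa]
  refine ⟨l, hl, hmem, fun v => ?_⟩
  exact key l [] rfl _ (fun w => by simp) v

variable {W : Type} {G : Digraph V} {S : Set V} {e : V → W}

theorem viewOf_copy {St : Type} (he : Set.InjOn e S) {ident : V → ℕ} {ident' : W → ℕ}
    {input : V → In} {input' : W → In} {mem : V → Option (St × Out)} {mem' : W → Option (St × Out)}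
    {v : V} (hS : ball G T v ⊆ S) (hid : ∀ a ∈ ball G T v, ident' (e a) = ident a)
    (hin : ∀ a ∈ ball G T v, input' (e a) = input a)
    (hmem : ∀ a ∈ ball G T v, mem' (e a) = mem a) :
    viewOf (copy G S e) ident' input' T mem' (e v) = viewOf G ident input T mem v := by
  have hb : ∀ p : W → Prop, (∃ w ∈ ball (copy G S e) T (e v), p w) ↔
      ∃ a ∈ ball G T v, p (e a) := by
    intro p
    rw [ball_copy he hS, Set.exists_mem_image]
  rw [viewOf, viewOf, View.mk.injEq]
  refine ⟨hid v (mem_ball_self _ _), ?_, ?_, ?_⟩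
  · ext p
    simp only [Set.mem_ofPred_eq, hb]
    refine exists_congr fun a => and_congr_right fun ha => ?_
    rw [hid a ha, hin a ha]
  · ext p
    simp only [Set.mem_ofPred_eq, hb]
    refine exists_congr fun a => and_congr_right fun ha => exists_congr fun b =>
      and_congr_right fun hb => ?_
    rw [hid a ha, hid b hb, copy_adj he (hS ha) (hS hb)]
  · ext p
    simp only [Set.mem_ofPred_eq, hb]
    refine exists_congr fun a => and_congr_right fun ha => ?_
    rw [hid a ha, hmem a ha]

/-- The rank orders the nodes by layer, and then by color. -/
def rank (G : Digraph V) (M T : ℕ) (χ : V → ℕ) (v : V) : ℕ :=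
  phase G M T χ v * (M + 1) + χ v

/-- The record of a node in a run by increasing rank only depends on a neighborhood of bounded
radius. -/
theorem record_copy (he : Set.InjOn e S) (hG : IsRootedForest G) {M D : ℕ} {χ : V → ℕ}
    (hD : 2 * T + 2 ≤ D) (hχ : IsDistColoring G M D χ) {ident' : W → ℕ} {ρ' : W → ℕ}
    {input : V → In} {input' : W → In} {v : V} (hS : ball G (22 * T + 16) v ⊆ S)
    (hid : ∀ a ∈ ball G (22 * T + 16) v, ident' (e a) = χ a)
    (hin : ∀ a ∈ ball G (22 * T + 16) v, input' (e a) = input a)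
    (hρ : ∀ a ∈ ball G (22 * T + 16) v, ρ' (e a) = rank G M T χ a) :
    record A n T (copy G S e) ident' input' ρ' (e v) =
      record A n T G χ input (rank G M T χ) v := by
  have step : ∀ w, ball G T w ⊆ ball G (22 * T + 16) v →
      (∀ a ∈ ball G T w, rank G M T χ a < rank G M T χ w →
        record A n T (copy G S e) ident' input' ρ' (e a) =
          record A n T G χ input (rank G M T χ) a) →
      record A n T (copy G S e) ident' input' ρ' (e w) =
        record A n T G χ input (rank G M T χ) w := by
    intro w hw ih
    rw [record, record]
    congr 1
    refine viewOf_copy T he (hw.trans hS) (fun a ha => hid a (hw ha)) (fun a ha => hin a (hw ha))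
      fun a ha => ?_
    rw [hρ a (hw ha), hρ w (hw (mem_ball_self _ _))]
    by_cases hlt : rank G M T χ a < rank G M T χ w
    · rw [dif_pos hlt, dif_pos hlt, ih a ha hlt]
    · rw [dif_neg hlt, dif_neg hlt]
  have layer : ∀ u, ball G (11 * T + 8) u ⊆ ball G (22 * T + 16) v →
      (∀ w ∈ ball G (11 * T + 8) u, phase G M T χ w < phase G M T χ u →
        record A n T (copy G S e) ident' input' ρ' (e w) =
          record A n T G χ input (rank G M T χ) w) →
      record A n T (copy G S e) ident' input' ρ' (e u) =
        record A n T G χ input (rank G M T χ) u := by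
    intro u hu hlow
    obtain ⟨C, hC, huC, hcl⟩ := exists_phase_component hG hD hχ u
    have main : ∀ N, ∀ w ∈ C, phase G M T χ w = phase G M T χ u → rank G M T χ w = N →
        record A n T (copy G S e) ident' input' ρ' (e w) =
          record A n T G χ input (rank G M T χ) w := by
      intro N
      induction N using Nat.strong_induction_on with
      | _ N ih =>
        intro w hw hph hN
        have hwu : ball G T w ⊆ ball G (11 * T + 8) u := fun a ha =>
          ball_mono (by omega) u (mem_ball_trans (hC hw) ha)
        refine step w (hwu.trans hu) fun a ha hlt => ?_
        rcases Nat.lt_trichotomy (phase G M T χ a) (phase G M T χ w) with h | h | h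
        · exact hlow a (hwu ha) (by omega)
        · exact ih _ (by omega) a (hcl w hw a ha (h.trans hph)) (h.trans hph) rfl
        · exfalso
          have h1 : (phase G M T χ w + 1) * (M + 1) ≤ phase G M T χ a * (M + 1) :=
            Nat.mul_le_mul_right _ h
          have h2 := hχ.le w
          rw [Nat.succ_mul] at h1
          unfold rank at hlt
          omega
    exact main _ u huC rfl rfl
  have hle : ∀ u, phase G M T χ u ≤ 1 := by
    intro u
    unfold phase
    split_ifs <;> omega
  refine layer v (ball_mono (by omega) v) fun w hw hlt => ?_
  refine layer w (fun a ha => ball_mono (by omega) v (mem_ball_trans hw ha)) fun a _ ha => ?_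
  have := hle v
  omega

end Simulation

/-! ### Permissibility of the simulated run -/

section Permissible

variable {In Out V : Type}

theorem CenteredLabeledGraph.Isomorphic.trans {H K L : CenteredLabeledGraph In Out}
    (h : H.Isomorphic K) (h' : K.Isomorphic L) : H.Isomorphic L := by
  obtain ⟨φ, h1, h2, h3⟩ := h
  obtain ⟨ψ, k1, k2, k3⟩ := h'
  refine ⟨φ.trans ψ, ?_, fun v => ?_, fun v => ?_⟩
  · rw [RelIso.trans_apply, h1, k1]
  · rw [RelIso.trans_apply, k2, h2]
  · rw [RelIso.trans_apply, k3, h3]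

theorem localView_copy_isomorphic [Finite V] {W : Type} [Finite W] {G : Digraph V} {S : Set V}
    {e : V → W} (he : Set.InjOn e S) {input : V → In} {input' : W → In} {out : V → Out}
    {out' : W → Out} {r : ℕ} {z : V} (hS : ball G r z ⊆ S)
    (hin : ∀ a ∈ ball G r z, input' (e a) = input a)
    (hout : ∀ a ∈ ball G r z, out' (e a) = out a) :
    (localView G input out r z).Isomorphic (localView (copy G S e) input' out' r (e z)) := by
  let f : ball G r z → ball (copy G S e) r (e z) := fun a => ⟨e a, map_mem_ball_copy hS a.2⟩
  have hf : Function.Bijective f := by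
    refine ⟨fun a b hab => Subtype.ext (he (hS a.2) (hS b.2) (Subtype.ext_iff.1 hab)), ?_⟩
    rintro ⟨x, hx⟩
    rw [ball_copy he hS] at hx
    obtain ⟨a, ha, rfl⟩ := hx
    exact ⟨⟨a, ha⟩, rfl⟩
  refine ⟨⟨Equiv.ofBijective f hf, fun {a b} => ?_⟩, rfl, ?_, ?_⟩
  · exact copy_adj he (hS a.2) (hS b.2)
  · exact fun a : ball G r z => hin a a.2
  · exact fun a : ball G r z => hout a a.2

theorem record_permissible [Finite V] {P : LabelingProblem In Out} {r Δ c : ℕ} (hc : 1 ≤ c)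
    (hP : P.IsLocallyCheckable r Δ) {A : SLOCALAlgorithm In Out} {τ : ℕ → ℕ}
    (hA : A.Solves P Δ c τ) {G : Digraph V} (hG : IsRootedForest G) (hΔ : MaxDegreeLE G Δ)
    {n D : ℕ} {χ : V → ℕ} (hD : 2 * (r + (22 * τ n + 16)) ≤ D) (hχ : IsDistColoring G n D χ)
    (input : V → In) :
    (fun v => (record A n (τ n) G χ input (rank G n (τ n) χ) v).2) ∈ P.permissible G input := by
  obtain ⟨𝒮, -, hS⟩ := hP
  rw [hS V G input _ hG.loopless hΔ]
  intro z
  have : Nonempty V := ⟨z⟩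
  let W := ↥(Finset.Icc 1 n)
  have : Finite W := inferInstanceAs (Finite ↥(Finset.Icc 1 n))
  let e : V → W := fun v => ⟨χ v, Finset.mem_Icc.2 ⟨hχ.one_le v, hχ.le v⟩⟩
  set S := ball G (r + (22 * τ n + 16)) z with hSdef
  have he : Set.InjOn e S := by
    intro a ha b hb hab
    by_contra hne
    refine hχ.ne a b (ball_mono ?_ a (mem_ball_trans (mem_ball_symm ha) hb)) hne
      (Subtype.ext_iff.1 hab)
    omega
  have hcard : Nat.card W = n := by
    rw [Nat.card_eq_fintype_card, Fintype.card_coe, Nat.card_Icc, Nat.add_sub_cancel]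
  set g : W → V := Function.invFunOn e S
  have hge : ∀ a ∈ S, g (e a) = a := fun a ha => he.leftInvOn_invFunOn ha
  let ident : W → ℕ := fun x => x
  have hid : Function.Injective ident := Subtype.val_injective
  let ρ : W → ℕ := fun x => phase G n (τ n) χ (g x) * (n + 1) + x
  have hρ : Function.Injective ρ := by
    intro x y hxy
    have hx := (Finset.mem_Icc.1 x.2).2
    have hy := (Finset.mem_Icc.1 y.2).2
    have h := congrArg (· % (n + 1)) hxy
    simp only [ρ, Nat.mul_add_mod', Nat.mod_eq_of_lt (Nat.lt_succ_of_le hx),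
      Nat.mod_eq_of_lt (Nat.lt_succ_of_le hy)] at h
    exact Subtype.ext h
  obtain ⟨order, hnd, hall, hrun⟩ := exists_run_eq_record A n (τ n) (copy G S e) ident
    (input ∘ g) hρ
  obtain ⟨out, hout, hsol⟩ := hA W (copy G S e) (isRootedForest_copy he hG)
    (maxDegreeLE_copy he hΔ) (input ∘ g) ident hid
    (fun x => ⟨(Finset.mem_Icc.1 x.2).1, by
      rw [hcard]
      exact (Finset.mem_Icc.1 x.2).2.trans (Nat.le_self_pow (by omega) n)⟩) order hnd hall
  rw [hS W _ _ _ (isRootedForest_copy he hG).loopless (maxDegreeLE_copy he hΔ)] at hout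
  obtain ⟨H, hH, hiso⟩ := hout (e z)
  refine ⟨H, hH, (localView_copy_isomorphic he ?_ ?_ ?_).trans hiso⟩
  · exact ball_mono (Nat.le_add_right _ _) z
  · intro a ha
    rw [Function.comp_apply, hge a (ball_mono (Nat.le_add_right _ _) z ha)]
  · intro a ha
    have hsub : ball G (22 * τ n + 16) a ⊆ S := fun b hb => mem_ball_trans ha hb
    have h1 := hsol (e a)
    rw [hcard, hrun, Option.map_some, Option.some_inj] at h1
    rw [← h1, record_copy A n (τ n) (M := n) he hG (D := D) (by omega) hχ hsub (fun b _ => rfl)]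
    · intro b hb
      rw [Function.comp_apply, hge b (hsub hb)]
    · intro b hb
      simp only [ρ, hge b (hsub hb), rank, e]

end Permissible

/-! ### The choice of the simulated number of nodes -/

theorem exists_pow_le {Δ : ℕ} (hΔ : 2 ≤ Δ) {T : ℕ → ℕ}
    (hT : (fun n : ℕ => (T n : ℝ)) =o[atTop] (fun n : ℕ => Real.logb (Δ : ℝ) (n : ℝ)))
    (a b : ℕ) : ∃ n, (Δ + 1) ^ (a * T n + b) ≤ n := by
  have hΔ1 : (1 : ℝ) < Δ := by exact_mod_cast hΔ
  have h1 : ∀ᶠ n : ℕ in atTop, ‖(T n : ℝ)‖ ≤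
      (1 / (4 * (a + 1)) : ℝ) * ‖Real.logb (Δ : ℝ) (n : ℝ)‖ :=
    hT.def (by positivity)
  have h2 : ∀ᶠ n : ℕ in atTop, (4 * b : ℝ) ≤ Real.logb (Δ : ℝ) (n : ℝ) :=
    ((Real.tendsto_logb_atTop hΔ1).comp tendsto_natCast_atTop_atTop).eventually_ge_atTop _
  obtain ⟨n, h1, h2, h3⟩ := (h1.and (h2.and (eventually_ge_atTop 1))).exists
  refine ⟨n, ?_⟩
  have hb : (0 : ℝ) ≤ 4 * b := by positivity
  rw [Real.norm_of_nonneg (by positivity), Real.norm_of_nonneg (hb.trans h2)] at h1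
  have hn : (0 : ℝ) < n := by exact_mod_cast h3
  have h4 : (4 * (a + 1) : ℝ) * T n ≤ Real.logb Δ n := by
    have : (0 : ℝ) < 4 * (a + 1) := by positivity
    calc (4 * (a + 1) : ℝ) * T n
        ≤ 4 * (a + 1) * (1 / (4 * (a + 1)) * Real.logb Δ n) := by gcongr
      _ = Real.logb Δ n := by field_simp
  have h5 : ((2 * (a * T n + b) : ℕ) : ℝ) ≤ Real.logb Δ n := by
    push_cast
    have : (0 : ℝ) ≤ T n := by positivity
    nlinarith
  have h6 : ((Δ ^ (2 * (a * T n + b)) : ℕ) : ℝ) ≤ n := by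
    rw [Real.le_logb_iff_rpow_le hΔ1 hn, Real.rpow_natCast] at h5
    exact_mod_cast h5
  have h7 : Δ ^ (2 * (a * T n + b)) ≤ n := by exact_mod_cast h6
  refine le_trans ?_ h7
  rw [pow_mul]
  exact Nat.pow_le_pow_left (by nlinarith) _

/-! ### Partial colorings -/

section Coloring

variable {V : Type} {G : Digraph V} {M D : ℕ}

/-- A partial coloring with colors from `{1, …, M}` in which nodes within distance `D` have
distinct colors; the color `0` stands for nodes that are not colored. -/
structure IsPartialColoring (G : Digraph V) (M D : ℕ) (C : V → ℕ) : Prop where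
  le : ∀ v, C v ≤ M
  ne : ∀ v w, w ∈ ball G D v → v ≠ w → C v ≠ 0 → C v ≠ C w

theorem IsPartialColoring.exists_extension [Finite V] (hM : ∀ v, (ball G D v).ncard ≤ M)
    {C : V → ℕ} (hC : IsPartialColoring G M D C) (F : Finset V) :
    ∃ C', IsPartialColoring G M D C' ∧ (∀ v, C v ≠ 0 → C' v = C v) ∧ ∀ v ∈ F, C' v ≠ 0 := by
  classical
  induction F using Finset.induction_on with
  | empty => exact ⟨C, hC, fun _ _ => rfl, by simp⟩
  | insert a F _ ih =>
    obtain ⟨C', hC', hext, hF⟩ := ih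
    by_cases ha : C' a = 0
    · obtain ⟨x, hx, hx'⟩ : ∃ x ∈ Set.Icc 1 M, x ∉ C' '' (ball G D a \ {a}) := by
        by_contra! hall
        have h1 := Set.ncard_le_ncard hall (Set.toFinite _)
        have h2 := Set.ncard_image_le (f := C') (Set.toFinite (ball G D a \ {a}))
        have h3 := Set.ncard_sdiff_singleton_add_one (mem_ball_self D a) (Set.toFinite (ball G D a))
        have h4 : (Set.Icc 1 M).ncard = M := by
          rw [← Finset.coe_Icc, Set.ncard_coe_finset, Nat.card_Icc, Nat.add_sub_cancel]
        have := hM a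
        omega
      have hx0 : x ≠ 0 := by
        have := hx.1
        omega
      refine ⟨Function.update C' a x, ⟨fun v => ?_, fun v w hw hne hv => ?_⟩, fun v hv => ?_,
        fun v hv => ?_⟩
      · by_cases hva : v = a
        · rw [hva, Function.update_self]
          exact hx.2
        · rw [Function.update_of_ne hva]
          exact hC'.le v
      · by_cases hva : v = a
        · subst hva
          rw [Function.update_self, Function.update_of_ne hne.symm]
          exact fun h => hx' ⟨w, ⟨hw, hne.symm⟩, h.symm⟩
        · rw [Function.update_of_ne hva] at hv ⊢
          by_cases hwa : w = a
          · subst hwa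
            rw [Function.update_self]
            exact fun h => hx' ⟨v, ⟨mem_ball_symm hw, hva⟩, h⟩
          · rw [Function.update_of_ne hwa]
            exact hC'.ne v w hw hne hv
      · have hva : v ≠ a := by
          rintro rfl
          exact hv ((hext v hv).symm.trans ha)
        rw [Function.update_of_ne hva, hext v hv]
      · by_cases hva : v = a
        · rwa [hva, Function.update_self]
        · rw [Function.update_of_ne hva]
          exact hF v (Finset.mem_of_mem_insert_of_ne hv hva)
    · refine ⟨C', hC', hext, fun v hv => ?_⟩
      rcases Finset.mem_insert.1 hv with rfl | hv
      · exact ha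
      · exact hF v hv

end Coloring

/-! ### The algorithm with constant locality -/

section Algorithm

variable {In Out : Type}

/-- The graph that is seen in a view, with the identifiers as nodes. -/
def viewGraph {St : Type} (w : View In Out St) : Digraph ℕ where
  Adj a b := (a, b) ∈ w.edges

open Classical in
/-- The input label of the node with identifier `a` in a view. -/
def viewInput [Nonempty In] {St : Type} (w : View In Out St) (a : ℕ) : In :=
  if h : ∃ i, (a, i) ∈ w.inputs then h.choose else Classical.arbitrary In

/-- `col` extends the partial colorings recorded in the view `w` to the radius-`K`
neighborhood of its center. -/
structure ExtendsColoring (M D K : ℕ) (w : View In Out (ℕ → ℕ)) (col : ℕ → ℕ) : Prop where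
  eq : ∀ p ∈ w.memory, ∀ a, p.2.1 a ≠ 0 → col a = p.2.1 a
  ne_zero : ∀ a ∈ ball (viewGraph w) K w.center, col a ≠ 0
  le : ∀ a ∈ ball (viewGraph w) K w.center, col a ≤ M
  ne : ∀ a ∈ ball (viewGraph w) K w.center, ∀ b ∈ ball (viewGraph w) D a, a ≠ b → col a ≠ col b

open Classical in
/-- A coloring of the nodes in a view that extends the recorded ones. -/
def chooseColoring (M D K : ℕ) (w : View In Out (ℕ → ℕ)) : ℕ → ℕ :=
  if h : ∃ col, ExtendsColoring M D K w col then h.choose else 0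

open Classical in
/-- Color the radius-`K` neighborhood of the current node, and simulate a run of `A` on `n` nodes
with the colors as identifiers, in which the nodes are processed by increasing rank. -/
def simulator [Nonempty In] (A : SLOCALAlgorithm In Out) (n T D K : ℕ) :
    SLOCALAlgorithm In Out where
  State := ℕ → ℕ
  step _ w :=
    (fun a => if a ∈ ball (viewGraph w) K w.center then chooseColoring n D K w a else 0,
      (record A n T (viewGraph w) (chooseColoring n D K w) (viewInput w)
        (rank (viewGraph w) n T (chooseColoring n D K w)) w.center).2)

variable {V : Type} {G : Digraph V} {ident : V → ℕ} {input : V → In} {n T D K : ℕ}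

theorem viewGraph_viewOf {St : Type} (k : ℕ) (mem : V → Option (St × Out)) (v : V) :
    viewGraph (viewOf G ident input k mem v) = copy G (ball G k v) ident := by
  ext a b
  constructor
  · rintro ⟨u, hu, w, hw, h, heq⟩
    exact ⟨u, hu, w, hw, h, (Prod.ext_iff.1 heq).1.symm, (Prod.ext_iff.1 heq).2.symm⟩
  · rintro ⟨u, hu, w, hw, h, rfl, rfl⟩
    exact ⟨u, hu, w, hw, h, rfl⟩

theorem viewInput_viewOf [Nonempty In] {St : Type} (hid : Function.Injective ident) {k : ℕ}
    (mem : V → Option (St × Out)) {v a : V} (ha : a ∈ ball G k v) :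
    viewInput (viewOf G ident input k mem v) (ident a) = input a := by
  have h : ∃ i, (ident a, i) ∈ (viewOf G ident input k mem v).inputs := ⟨input a, a, ha, rfl⟩
  rw [viewInput, dif_pos h]
  obtain ⟨b, -, hb⟩ := h.choose_spec
  refine (Prod.ext_iff.1 hb).2.trans ?_
  exact congrArg input (hid (Prod.ext_iff.1 hb).1).symm

/-- The records are the restrictions of a partial coloring `C` to the radius-`K` neighborhoods of
the processed nodes, and the outputs are those of a simulated run. -/
structure IsConsistent (A : SLOCALAlgorithm In Out) (G : Digraph V) (ident : V → ℕ)
    (input : V → In) (n T D K : ℕ) (mem : V → Option ((ℕ → ℕ) × Out)) (C : V → ℕ) : Prop where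
  coloring : IsPartialColoring G n D C
  colored : ∀ a, C a ≠ 0 → ∃ u, (mem u).isSome ∧ a ∈ ball G K u
  ne_zero : ∀ u p, mem u = some p → ∀ a ∈ ball G K u, C a ≠ 0
  state_eq : ∀ u p, mem u = some p → ∀ a ∈ ball G K u, p.1 (ident a) = C a
  exists_of_state : ∀ u p, mem u = some p → ∀ x, p.1 x ≠ 0 → ∃ a ∈ ball G K u, ident a = x
  output_eq : ∀ u p, mem u = some p → ∀ χ, IsDistColoring G n D χ →
    (∀ a ∈ ball G K u, χ a = C a) → p.2 = (record A n T G χ input (rank G n T χ) u).2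

theorem exists_extendsColoring [Finite V] {A : SLOCALAlgorithm In Out}
    (hn : ∀ v, (ball G D v).ncard ≤ n) (hid : Function.Injective ident)
    {mem : V → Option ((ℕ → ℕ) × Out)} {C : V → ℕ}
    (hmem : IsConsistent A G ident input n T D K mem C) (v : V) :
    ∃ col, ExtendsColoring n D K (viewOf G ident input (2 * K + D) mem v) col := by
  obtain ⟨C', hC', hext, hF⟩ := hmem.coloring.exists_extension hn
    (Set.toFinite (ball G K v)).toFinset
  have hcenter : (viewOf G ident input (2 * K + D) mem v).center = ident v := rfl
  have happ : ∀ a, Function.extend ident C' 0 (ident a) = C' a := fun a => hid.extend_apply _ _ a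
  have hball : ∀ x ∈ ball (copy G (ball G (2 * K + D) v) ident) K (ident v),
      ∃ a ∈ ball G K v, a ∈ ball G (2 * K + D) v ∧ ident a = x := by
    intro x hx
    obtain ⟨a, ⟨ha, ha'⟩, rfl⟩ := ball_copy_subset hid.injOn (mem_ball_self _ _) K hx
    exact ⟨a, ha, ha', rfl⟩
  have hzero : ∀ a ∈ ball G K v, C' a ≠ 0 := fun a ha => hF a (by simpa using ha)
  refine ⟨Function.extend ident C' 0, ⟨?_, ?_, ?_, ?_⟩⟩
  · rintro _ ⟨u, hu, p, hp, rfl⟩ x hx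
    obtain ⟨a, ha, rfl⟩ := hmem.exists_of_state u p hp x hx
    simp only
    rw [happ, hmem.state_eq u p hp a ha, hext a (hmem.ne_zero u p hp a ha)]
  · rw [viewGraph_viewOf, hcenter]
    intro x hx
    obtain ⟨a, ha, -, rfl⟩ := hball x hx
    rw [happ]
    exact hzero a ha
  · rw [viewGraph_viewOf, hcenter]
    intro x hx
    obtain ⟨a, ha, -, rfl⟩ := hball x hx
    rw [happ]
    exact hC'.le a
  · rw [viewGraph_viewOf, hcenter]
    intro x hx y hy hne
    obtain ⟨a, ha, haS, rfl⟩ := hball x hx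
    obtain ⟨b, ⟨hb, -⟩, rfl⟩ := ball_copy_subset hid.injOn haS D hy
    rw [happ, happ]
    exact hC'.ne a b hb (fun h => hne (congrArg ident h)) (hzero a ha)

theorem isConsistent_process [Nonempty In] [Finite V] {A : SLOCALAlgorithm In Out}
    (hG : IsRootedForest G) (hn : ∀ v, (ball G D v).ncard ≤ n) (hid : Function.Injective ident)
    (hD : 2 * T + 2 ≤ D)
    (hK : (22 * T + 16) + (7 * T + 4 + 2 * ((2 * T + 2) * (n + (2 * T + 2)))) ≤ K) (N : ℕ)
    {mem : V → Option ((ℕ → ℕ) × Out)} {C : V → ℕ}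
    (hmem : IsConsistent A G ident input n T D K mem C) (v : V) :
    ∃ C', IsConsistent A G ident input n T D K
      ((simulator A n T D K).process N (2 * K + D) G ident input mem v) C' := by
  classical
  set w := viewOf G ident input (2 * K + D) mem v with hw
  have hcol : ExtendsColoring n D K w (chooseColoring n D K w) := by
    rw [chooseColoring, dif_pos (exists_extendsColoring hn hid hmem v)]
    exact (exists_extendsColoring hn hid hmem v).choose_spec
  have hproc : (simulator A n T D K).process N (2 * K + D) G ident input mem v =
      Function.update mem v (some ((simulator A n T D K).step N w)) := by
    unfold SLOCALAlgorithm.process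
    rfl
  rw [hproc]
  have hstep : (simulator A n T D K).step N w =
      (fun a => if a ∈ ball (viewGraph w) K w.center then chooseColoring n D K w a else 0,
        (record A n T (viewGraph w) (chooseColoring n D K w) (viewInput w)
          (rank (viewGraph w) n T (chooseColoring n D K w)) w.center).2) := rfl
  rw [hstep]
  set col := chooseColoring n D K w
  have hgraph : viewGraph w = copy G (ball G (2 * K + D) v) ident := viewGraph_viewOf _ _ _
  have hinput : ∀ a ∈ ball G (2 * K + D) v, viewInput w (ident a) = input a :=
    fun a ha => viewInput_viewOf hid _ ha
  have hcenter : w.center = ident v := rfl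
  have hballK : ball (viewGraph w) K w.center = ident '' ball G K v := by
    rw [hgraph, hcenter]
    exact ball_copy hid.injOn (ball_mono (by omega) v)
  have hmemK : ∀ a, ident a ∈ ball (viewGraph w) K w.center ↔ a ∈ ball G K v := by
    intro a
    rw [hballK]
    exact hid.mem_set_image
  have hcolC : ∀ a ∈ ball G (K + D) v, C a ≠ 0 → col (ident a) = C a := by
    intro a ha hCa
    obtain ⟨u, hu, hau⟩ := hmem.colored a hCa
    obtain ⟨p, hp⟩ := Option.isSome_iff_exists.1 hu
    have huv : u ∈ ball G (2 * K + D) v :=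
      ball_mono (by omega) v (mem_ball_trans ha (mem_ball_symm hau))
    have hst := hmem.state_eq u p hp a hau
    rw [← hst]
    exact hcol.eq (ident u, p) ⟨u, huv, p, hp, rfl⟩ (ident a) (by simp only; rwa [hst])
  have hcolne : ∀ a ∈ ball G K v, ∀ b ∈ ball G D a, a ≠ b → col (ident a) ≠ col (ident b) := by
    intro a ha b hb hne
    refine hcol.ne _ ((hmemK a).2 ha) _ ?_ (fun h => hne (hid h))
    rw [hgraph]
    exact map_mem_ball_copy (fun x hx => ball_mono (by omega) v (mem_ball_trans ha hx)) hb
  let C' : V → ℕ := fun a => if a ∈ ball G K v then col (ident a) else C a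
  have hin : ∀ a ∈ ball G K v, C' a = col (ident a) := fun a ha => if_pos ha
  have hout : ∀ a, a ∉ ball G K v → C' a = C a := fun a ha => if_neg ha
  have hpos : ∀ a ∈ ball G K v, C' a ≠ 0 := fun a ha => by
    rw [hin a ha]
    exact hcol.ne_zero _ ((hmemK a).2 ha)
  have hext : ∀ a, C a ≠ 0 → C' a = C a := by
    intro a ha
    by_cases hav : a ∈ ball G K v
    · rw [hin a hav, hcolC a (ball_mono (by omega) v hav) ha]
    · exact hout a hav
  have hnew : ∀ a ∈ ball G K v, ∀ b ∈ ball G D a, a ≠ b → C' a ≠ C' b := by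
    intro a ha b hb hne
    by_cases hCb : b ∈ ball G K v ∨ C b ≠ 0
    · have : C' b = col (ident b) := by
        by_cases hbv : b ∈ ball G K v
        · exact hin b hbv
        · rw [hout b hbv, hcolC b (mem_ball_trans ha hb) (hCb.resolve_left hbv)]
      rw [hin a ha, this]
      exact hcolne a ha b hb hne
    · push Not at hCb
      rw [hout b hCb.1, hCb.2]
      exact hpos a ha
  refine ⟨C', ⟨⟨fun a => ?_, fun a b hb hne ha => ?_⟩, ?_, ?_, ?_, ?_, ?_⟩⟩
  · by_cases hav : a ∈ ball G K v
    · rw [hin a hav]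
      exact hcol.le _ ((hmemK a).2 hav)
    · rw [hout a hav]
      exact hmem.coloring.le a
  · by_cases hav : a ∈ ball G K v
    · exact hnew a hav b hb hne
    · by_cases hbv : b ∈ ball G K v
      · exact (hnew b hbv a (mem_ball_symm hb) hne.symm).symm
      · rw [hout a hav] at ha ⊢
        rw [hout b hbv]
        exact hmem.coloring.ne a b hb hne ha
  · intro a ha
    by_cases hav : a ∈ ball G K v
    · exact ⟨v, by rw [Function.update_self]; rfl, hav⟩
    · rw [hout a hav] at ha
      obtain ⟨u, hu, hau⟩ := hmem.colored a ha
      refine ⟨u, ?_, hau⟩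
      by_cases huv : u = v
      · rw [huv, Function.update_self]
        rfl
      · rwa [Function.update_of_ne huv]
  · intro u p hp a ha
    by_cases huv : u = v
    · subst huv
      exact hpos a ha
    · rw [Function.update_of_ne huv] at hp
      have := hmem.ne_zero u p hp a ha
      rwa [hext a this]
  · intro u p hp a ha
    by_cases huv : u = v
    · subst huv
      rw [Function.update_self, Option.some_inj] at hp
      subst hp
      simp only
      rw [if_pos ((hmemK a).2 ha), hin a ha]
    · rw [Function.update_of_ne huv] at hp
      rw [hmem.state_eq u p hp a ha, hext a (hmem.ne_zero u p hp a ha)]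
  · intro u p hp x hx
    by_cases huv : u = v
    · subst huv
      rw [Function.update_self, Option.some_inj] at hp
      subst hp
      simp only at hx
      by_cases hxK : x ∈ ball (viewGraph w) K w.center
      · rwa [hballK] at hxK
      · rw [if_neg hxK] at hx
        exact absurd rfl hx
    · rw [Function.update_of_ne huv] at hp
      exact hmem.exists_of_state u p hp x hx
  · intro u p hp χ hχ hχC
    by_cases huv : u = v
    · subst huv
      rw [Function.update_self, Option.some_inj] at hp
      subst hp
      simp only
      have hχcol : ∀ a ∈ ball G K u, col (ident a) = χ a := fun a ha => by
        rw [hχC a ha, hin a ha]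
      have : Nonempty V := ⟨u⟩
      have hsub : ball G (22 * T + 16) u ⊆ ball G K u := ball_mono (by omega) u
      have hsub' : ball G K u ⊆ ball G (2 * K + D) u := ball_mono (by omega) u
      rw [hgraph, hcenter, record_copy A n T (S := ball G (2 * K + D) u) hid.injOn hG hD hχ
        (hsub.trans hsub') (fun a ha => hχcol a (hsub ha))
        (fun a ha => hinput a (hsub' (hsub ha)))]
      intro a ha
      have haK : ball G (7 * T + 4 + 2 * ((2 * T + 2) * (n + (2 * T + 2)))) a ⊆ ball G K u :=
        fun b hb => ball_mono hK u (mem_ball_trans ha hb)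
      rw [rank, rank, hχcol a (hsub ha), phase_copy hG (isRootedForest_copy hid.injOn hG)
        hid.injOn hχ.le le_rfl (haK.trans hsub') fun b hb => hχcol b (haK hb)]
    · rw [Function.update_of_ne huv] at hp
      refine hmem.output_eq u p hp χ hχ fun a ha => ?_
      rw [hχC a ha, hext a (hmem.ne_zero u p hp a ha)]

theorem process_self_isSome (B : SLOCALAlgorithm In Out) (N k : ℕ) (input : V → In)
    (mem : V → Option (B.State × Out)) (v : V) :
    (B.process N k G ident input mem v v).isSome := by
  classical
  unfold SLOCALAlgorithm.process
  rw [Function.update_self]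
  rfl

theorem process_of_ne (B : SLOCALAlgorithm In Out) (N k : ℕ) (input : V → In)
    (mem : V → Option (B.State × Out)) (v : V) {u : V} (h : u ≠ v) :
    B.process N k G ident input mem v u = mem u := by
  classical
  unfold SLOCALAlgorithm.process
  exact Function.update_of_ne h _ _

theorem isConsistent_foldl [Nonempty In] [Finite V] {A : SLOCALAlgorithm In Out}
    (hG : IsRootedForest G) (hn : ∀ v, (ball G D v).ncard ≤ n) (hid : Function.Injective ident)
    (hD : 2 * T + 2 ≤ D)
    (hK : (22 * T + 16) + (7 * T + 4 + 2 * ((2 * T + 2) * (n + (2 * T + 2)))) ≤ K) (N : ℕ)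
    (order : List V) {mem : V → Option ((ℕ → ℕ) × Out)} {C : V → ℕ}
    (hmem : IsConsistent A G ident input n T D K mem C) :
    (∃ C', IsConsistent A G ident input n T D K
      (order.foldl ((simulator A n T D K).process N (2 * K + D) G ident input) mem) C') ∧
    ∀ v, (mem v).isSome ∨ v ∈ order →
      (order.foldl ((simulator A n T D K).process N (2 * K + D) G ident input) mem v).isSome := by
  induction order generalizing mem C with
  | nil => exact ⟨⟨C, hmem⟩, fun v hv => hv.resolve_right (by simp)⟩
  | cons a l ih =>
    obtain ⟨C', hC'⟩ := isConsistent_process hG hn hid hD hK N hmem a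
    obtain ⟨h1, h2⟩ := ih hC'
    refine ⟨h1, fun v hv => h2 v ?_⟩
    by_cases hva : v = a
    · left
      rw [hva]
      exact process_self_isSome _ _ _ _ _ _
    · rcases hv with hv | hv
      · exact Or.inl ((congrArg Option.isSome (process_of_ne _ _ _ _ _ _ hva)).trans hv)
      · exact Or.inr (List.mem_of_ne_of_mem hva hv)

end Algorithm

end LCLModel

end

theorem mainTheorem7 {In Out : Type} [Finite In] [Finite Out]
    (P : LCLModel.LabelingProblem In Out) (r Δ c : ℕ) (hΔ : 2 ≤ Δ) (hc : 1 ≤ c)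
    (hP : P.IsLocallyCheckable r Δ)
    (A : LCLModel.SLOCALAlgorithm In Out) (T : ℕ → ℕ)
    (hT : (fun n : ℕ => (T n : ℝ)) =o[atTop] (fun n : ℕ => Real.logb (Δ : ℝ) (n : ℝ)))
    (hA : A.Solves P Δ c T) :
    ∃ (B : LCLModel.SLOCALAlgorithm In Out) (k : ℕ), B.Solves P Δ c (fun _ => k) := by
  rcases isEmpty_or_nonempty In with hIn | hIn
  · refine ⟨A, 0, fun V _ G hG hdeg input ident hid hrange order hnd hall => ?_⟩
    obtain ⟨out, hout, -⟩ := hA V G hG hdeg input ident hid hrange order hnd hall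
    exact ⟨out, hout, fun v => hIn.elim (input v)⟩
  · obtain ⟨n, hn⟩ := LCLModel.exists_pow_le hΔ hT 44 (2 * (r + 16))
    set D := 44 * T n + 2 * (r + 16) with hD
    set K := (22 * T n + 16) +
      (7 * T n + 4 + 2 * ((2 * T n + 2) * (n + (2 * T n + 2)))) with hK
    refine ⟨LCLModel.simulator A n (T n) D K, 2 * K + D,
      fun V _ G hG hdeg input ident hid _ order _ hall => ?_⟩
    have hcard : ∀ v, (LCLModel.ball G D v).ncard ≤ n :=
      fun v => (LCLModel.ncard_ball_le hdeg D v).trans hn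
    have hinit : LCLModel.IsConsistent A G ident input n (T n) D K (fun _ => none) 0 :=
      ⟨⟨fun _ => Nat.zero_le _, fun _ _ _ _ h => absurd rfl h⟩, fun _ h => absurd rfl h,
        by simp, by simp, by simp, by simp⟩
    obtain ⟨⟨C, hC⟩, hsome⟩ := LCLModel.isConsistent_foldl hG hcard hid (by omega) hK.ge
      (Nat.card V) order hinit
    have hget : ∀ v, ∃ p, (LCLModel.simulator A n (T n) D K).run (Nat.card V) (2 * K + D) G ident
        input order v = some p :=
      fun v => Option.isSome_iff_exists.1 (hsome v (Or.inr (hall v)))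
    have hχ : LCLModel.IsDistColoring G n D C := by
      have hne : ∀ v, C v ≠ 0 := fun v => by
        obtain ⟨p, hp⟩ := hget v
        exact hC.ne_zero v p hp v (LCLModel.mem_ball_self _ _)
      exact ⟨fun v => Nat.one_le_iff_ne_zero.2 (hne v), hC.coloring.le,
        fun v w hw hvw => hC.coloring.ne v w hw hvw (hne v)⟩
    refine ⟨_, LCLModel.record_permissible hc hP hA hG hdeg (by omega) hχ input, fun v => ?_⟩
    obtain ⟨p, hp⟩ := hget v
    rw [hp, Option.map_some, hC.output_eq v p hp C hχ fun _ _ => rfl]
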